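/- Let $n\ge 2$, $m\ge 1$ be fixed, and let $F_x,F_y$ be fixed probability laws on $\mathbb R$ with mean $0$ and finite fourth moment. For every dimension $d$ let $\mathbf A=\mathbf A^{(d)},\mathbf B=\mathbf B^{(d)}\in\mathbb R^{d\times d}$ and $\mu=\mu^{(d)}\in\mathbb R^d$, with $k$-th rows $a_k^\top,b_k^\top$, and let $x_i=(x_{i1},\dots,x_{id})^\top$ $(1\le i\le n)$ and $y_j=(y_{j1},\dots,y_{jd})^\top$ $(1\le j\le m)$ have mutually independent entries, those of the $x_i$ with law $F_x$ and those of the $y_j$ with law $F_y$. Put $X_i=\mathbf A x_i$, $Y_j=\mathbf B y_j+\mu$ and $$D(X_i)=\begin{pmatrix}\frac1{n-1}\sum_{k\ne i}\|X_k-X_i\|_2^2\\ \frac1m\sum_{k=1}^m\|Y_k-X_i\|_2^2\end{pmatrix},\qquad \mu_{D_X}=\mathbb E\,D(X_i),\qquad \Sigma_{D_X}=\mathsf{Cov}(D(X_i)).$$ Let $s=\lfloor d^{1/5}\rfloor$, $t=\lfloor d/s\rfloor$, let $m_0\in\mathbb N$ be fixed, and for $1\le i\le t$ let $$R_i=\sum_{k=(i-1)s+1}^{is-m_0}\begin{pmatrix}\frac1{n-1}\sum_{j\ne1}(a_k^\top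 x_j-a_k^\top x_1)^2\\ \frac1m\sum_{j=1}^m(b_k^\top y_j-a_k^\top x_1+\mu_k)^2\end{pmatrix},\qquad \Sigma_t=\mathsf{Cov}\Big(\sum_{i=1}^tR_i\Big).$$ Assume that, for constants $c_0,\mu_0$ not depending on $d$: $a_{ij}=b_{ij}=0$ whenever $|i-j|\ge m_0$; $|a_{ij}|,|b_{ij}|<c_0$ and $|\mu_i|<\mu_0$ for all $i,j$; $\Sigma_t$ is positive definite for all large $d$; and $$\lim_{d\to\infty}\sum_{i=1}^t\mathbb E\big\|\Sigma_t^{-1/2}R_i\big\|_2^3=0 .$$ Then, for every $i\in\{1,\dots,n\}$, the vector $Z_d=\frac1{\sqrt d}\big(D(X_i)-\mu_{D_X}\big)$ is asymptotically (bivariate, possibly degenerate) normal as $d\to\infty$, with mean $0$ and covariance $\frac1d\Sigma_{D_X}$, in the following sense. 1. For every bounded continuous $f:\mathbb R^2\to\mathbb R$, $\ \mathbb E f(Z_d)-\int f\,dN\big(0,\tfrac1d\Sigma_{D_X}\big)\to0$. 2. Whenever $\frac1d\Sigma_{D_X}\to S$ for a matrix $S$, $Z_d$ converges in distribution to $N(0,S)$.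 3. Every subsequence of $(Z_d)_d$ has a further subsequence that converges in distribution to some $N(0,S)$ with $S$ positive semidefinite. -/

import Mathlib

open MeasureTheory ProbabilityTheory Filter Topology Matrix
open scoped ENNReal

namespace BandCLT

noncomputable section

/-- The raw variables `x i k` (`i` a sample index of the first class, `k` a coordinate) and `y j k`
(second class) on one probability space: every `x i k` has law `Fx`, every `y j k` has law `Fy`,
and all of them together are mutually independent. -/
structure RawSample {Ω : Type*} [MeasurableSpace Ω] (P : Measure Ω) {n m d : ℕ}
    (Fx Fy : Measure ℝ) (x : Fin n → Fin d → Ω → ℝ) (y : Fin m → Fin d → Ω → ℝ) : Prop where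
  law_x : ∀ i k, HasLaw (x i k) Fx P
  law_y : ∀ j k, HasLaw (y j k) Fy P
  indep : iIndepFun
    (Sum.elim (fun p : Fin n × Fin d => x p.1 p.2) (fun q : Fin m × Fin d => y q.1 q.2)) P

/-- The observation `X_i = A (x_{i1}, …, x_{id})ᵀ`. -/
def obsX {Ω : Type*} {n d : ℕ} (A : Matrix (Fin d) (Fin d) ℝ) (x : Fin n → Fin d → Ω → ℝ)
    (i : Fin n) (ω : Ω) : EuclideanSpace ℝ (Fin d) :=
  WithLp.toLp 2 (A *ᵥ fun k => x i k ω)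

/-- The observation `Y_j = B (y_{j1}, …, y_{jd})ᵀ + μ`. -/
def obsY {Ω : Type*} {m d : ℕ} (B : Matrix (Fin d) (Fin d) ℝ) (μ : Fin d → ℝ)
    (y : Fin m → Fin d → Ω → ℝ) (j : Fin m) (ω : Ω) : EuclideanSpace ℝ (Fin d) :=
  WithLp.toLp 2 ((B *ᵥ fun k => y j k ω) + μ)

/-- The distance mean vector `D(X_i) = (D_X(X_i), D_Y(X_i))`: the average squared Euclidean distance
from `X_i` to the other `X_k`, and the average squared Euclidean distance from `X_i` to the `Y_k`. -/
def distMean {Ω : Type*} {n m d : ℕ} (A B : Matrix (Fin d) (Fin d) ℝ) (μ : Fin d → ℝ)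
    (x : Fin n → Fin d → Ω → ℝ) (y : Fin m → Fin d → Ω → ℝ) (i : Fin n) (ω : Ω) :
    EuclideanSpace ℝ (Fin 2) :=
  !₂[1 / ((n : ℝ) - 1) * ∑ k ∈ Finset.univ.erase i, ‖obsX A x k ω - obsX A x i ω‖ ^ 2,
     1 / (m : ℝ) * ∑ k, ‖obsY B μ y k ω - obsX A x i ω‖ ^ 2]

/-- The covariance matrix of a random vector in the plane. -/
def covMat {Ω : Type*} [MeasurableSpace Ω] (P : Measure Ω) (V : Ω → EuclideanSpace ℝ (Fin 2)) :
    Matrix (Fin 2) (Fin 2) ℝ :=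
  Matrix.of fun a b => cov[fun ω => V ω a, fun ω => V ω b; P]

/-- The block length `s = ⌊d^{1/5}⌋`. -/
def blockLen (d : ℕ) : ℕ := ⌊(d : ℝ) ^ (1 / 5 : ℝ)⌋₊

/-- The number of blocks `t = ⌊d / s⌋`. -/
def numBlocks (d : ℕ) : ℕ := d / blockLen d

/-- The rows numbered from `(i-1)s + 1` to `is - m₀`, for a block number `i ≥ 1`. Rows are counted
from one, so `k : Fin d` is the row with number `k + 1`. -/
def blockRows (d m₀ i : ℕ) : Finset (Fin d) :=
  {k : Fin d | (i - 1) * blockLen d + 1 ≤ (k : ℕ) + 1 ∧ (k : ℕ) + 1 + m₀ ≤ i * blockLen d}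

/-- The contribution of row `k` to the distance mean vector of the observation with index `p`;
`A k` and `B k` are the `k`-th rows. -/
def rowTerm {Ω : Type*} {n m d : ℕ} (A B : Matrix (Fin d) (Fin d) ℝ) (μ : Fin d → ℝ)
    (x : Fin n → Fin d → Ω → ℝ) (y : Fin m → Fin d → Ω → ℝ) (p : Fin n) (k : Fin d) (ω : Ω) :
    EuclideanSpace ℝ (Fin 2) :=
  !₂[1 / ((n : ℝ) - 1) * ∑ j ∈ Finset.univ.erase p,
        (A k ⬝ᵥ (fun l => x j l ω) - A k ⬝ᵥ (fun l => x p l ω)) ^ 2,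
     1 / (m : ℝ) * ∑ j,
        (B k ⬝ᵥ (fun l => y j l ω) - A k ⬝ᵥ (fun l => x p l ω) + μ k) ^ 2]

/-- The block sum `R_i`. -/
def blockSum {Ω : Type*} {n m d : ℕ} (m₀ : ℕ) (A B : Matrix (Fin d) (Fin d) ℝ) (μ : Fin d → ℝ)
    (x : Fin n → Fin d → Ω → ℝ) (y : Fin m → Fin d → Ω → ℝ) (p : Fin n) (i : ℕ) (ω : Ω) :
    EuclideanSpace ℝ (Fin 2) :=
  ∑ k ∈ blockRows d m₀ i, rowTerm A B μ x y p k ω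

/-- The covariance matrix `Σ_t` of `R_1 + … + R_t`. -/
def blockCov {Ω : Type*} [MeasurableSpace Ω] (P : Measure Ω) {n m d : ℕ} (m₀ : ℕ)
    (A B : Matrix (Fin d) (Fin d) ℝ) (μ : Fin d → ℝ)
    (x : Fin n → Fin d → Ω → ℝ) (y : Fin m → Fin d → Ω → ℝ) (p : Fin n) :
    Matrix (Fin 2) (Fin 2) ℝ :=
  covMat P fun ω => ∑ i ∈ Finset.Icc 1 (numBlocks d), blockSum m₀ A B μ x y p i ω

open scoped MatrixOrder in
/-- `S ^ (-1/2)` for a positive definite matrix `S`. -/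
def invSqrt (S : Matrix (Fin 2) (Fin 2) ℝ) : Matrix (Fin 2) (Fin 2) ℝ := (CFC.sqrt S)⁻¹

/-- The Lyapunov sum `∑_{i ≤ t} E ‖Σ_t^{-1/2} R_i‖₂³`, with values in `[0, ∞]`, so that an infinite
third moment makes it infinite. -/
def lyapunovSum {Ω : Type*} [MeasurableSpace Ω] (P : Measure Ω) {n m d : ℕ} (m₀ : ℕ)
    (A B : Matrix (Fin d) (Fin d) ℝ) (μ : Fin d → ℝ)
    (x : Fin n → Fin d → Ω → ℝ) (y : Fin m → Fin d → Ω → ℝ) (p : Fin n) : ℝ≥0∞ :=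
  ∑ i ∈ Finset.Icc 1 (numBlocks d),
    ∫⁻ ω, ‖(WithLp.toLp 2 (invSqrt (blockCov P m₀ A B μ x y p) *ᵥ
      (WithLp.ofLp (blockSum m₀ A B μ x y p i ω))) : EuclideanSpace ℝ (Fin 2))‖ₑ ^ 3 ∂P

/-- The normalized vector `(1/√d) (D(X_i) - μ_{D_X})`, where `μ_{D_X} = E D(X_i)`. -/
def normalizedDist {Ω : Type*} [MeasurableSpace Ω] (P : Measure Ω) {n m d : ℕ}
    (A B : Matrix (Fin d) (Fin d) ℝ) (μ : Fin d → ℝ)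
    (x : Fin n → Fin d → Ω → ℝ) (y : Fin m → Fin d → Ω → ℝ) (i : Fin n) (ω : Ω) :
    EuclideanSpace ℝ (Fin 2) :=
  (1 / √(d : ℝ)) • (distMean A B μ x y i ω - ∫ ω', distMean A B μ x y i ω' ∂P)

end

end BandCLT

/-! Fix a direction `ξ`. A squared Euclidean norm is a sum over coordinates, so the projection of
`D(X_i)` on `ξ` is a sum of `d` row contributions (`distMean_eq_sum_rowTerm`). By the band
condition, row `k` sees only raw variables in columns at distance less than `m₀` from `k`, so groups
of rows at mutual distance at least `2 m₀` are independent: every row has a dependency neighbourhood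
of at most `4 m₀` rows. A row is quadratic in boundedly many raw variables, with bounded
coefficients, so fourth moments make the squares of the rows uniformly integrable.

For bounded centred summands `U k` with sum `W`, a Stein-type expansion of `E U_k e^{itW}` over the
neighbourhood of `k` shows that `φ(t) = E e^{itW}` nearly solves `φ' = -t Var(W) φ`; integrating
from 0 to 1 compares `φ(1)` with `e^{-Var(W)/2}` (`norm_integral_cis_sub_exp_le`). Summands of size
`M/√d` give an error of order `M³/√d`. Nothing is divided by the variance, so degenerate limits do
no harm. Truncation extends this to uniformly integrable squares (`tendsto_integral_cis_sub_exp`).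

The matrices `Σ_D/d` stay bounded, so each subsequence has a further one along which they converge,
and Lévy's continuity theorem turns the comparison of characteristic functions into the three
assertions (`asymptotic_normality_of_charFun`). -/

namespace BandCLT

noncomputable section

/-! ### Central limit theorem for bounded, locally dependent summands -/

/-- The complex number `e^{ix}`. -/
def cis (x : ℝ) : ℂ := Complex.exp (x * Complex.I)

lemma norm_cis (x : ℝ) : ‖cis x‖ = 1 := Complex.norm_exp_ofReal_mul_I x

lemma cis_add (x y : ℝ) : cis (x + y) = cis x * cis y := by
  simp [cis, add_mul, Complex.exp_add]

@[fun_prop]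
lemma continuous_cis : Continuous cis := by unfold cis; fun_prop

@[fun_prop]
lemma measurable_cis : Measurable cis := continuous_cis.measurable

lemma norm_cis_sub_one_le (x : ℝ) : ‖cis x - 1‖ ≤ |x| := by
  have := Real.norm_exp_I_mul_ofReal_sub_one_le (x := x)
  rwa [mul_comm, Real.norm_eq_abs] at this

lemma norm_cis_sub_cis_le (x y : ℝ) : ‖cis x - cis y‖ ≤ |x - y| := by
  have h : cis x - cis y = cis y * (cis (x - y) - 1) := by
    rw [mul_sub, ← cis_add]; simp
  rw [h, norm_mul, norm_cis, one_mul]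
  exact norm_cis_sub_one_le _

/-- Taylor's bound serves for `|x| ≤ 1`; beyond that, two terms of size `|x|` are already below `2 x
^ 2`. -/
lemma norm_cis_sub_one_sub_le (x : ℝ) : ‖cis x - 1 - x * Complex.I‖ ≤ 2 * x ^ 2 := by
  by_cases hx : |x| ≤ 1
  · have h := Complex.norm_exp_sub_one_sub_id_le (x := x * Complex.I) (by simpa using hx)
    simp only [norm_mul, Complex.norm_real, Complex.norm_I, mul_one, Real.norm_eq_abs,
      sq_abs] at h
    unfold cis
    nlinarith [sq_nonneg x]
  · push Not at hx
    calc ‖cis x - 1 - x * Complex.I‖ ≤ ‖cis x - 1‖ + ‖(x : ℂ) * Complex.I‖ := norm_sub_le _ _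
      _ ≤ |x| + |x| := by
        gcongr
        · exact norm_cis_sub_one_le x
        · simp
      _ ≤ 2 * x ^ 2 := by rw [← sq_abs]; nlinarith

variable {Ω κ E : Type*} [MeasurableSpace Ω] [MeasurableSpace E] {P : Measure Ω}

/-- The sets `nb k` are dependency neighbourhoods of the family `U`: the members with indices in
`S` are independent of those with indices in `T` as soon as `T` avoids the neighbourhoods of all
members of `S`. -/
def IsDependencyNbhd (P : Measure Ω) (nb : κ → Finset κ) (U : κ → Ω → E) : Prop :=
  ∀ S T : Finset κ, (∀ s ∈ S, Disjoint (nb s) T) →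
    IndepFun (fun ω (s : S) => U s ω) (fun ω (t : T) => U t ω) P

lemma IsDependencyNbhd.comp {F : Type*} [MeasurableSpace F] {nb : κ → Finset κ} {U : κ → Ω → E}
    (h : IsDependencyNbhd P nb U) {g : κ → E → F} (hg : ∀ k, Measurable (g k)) :
    IsDependencyNbhd P nb (fun k ω => g k (U k ω)) := by
  intro S T hST
  exact (h S T hST).comp (φ := fun v (s : S) => g s (v s)) (ψ := fun v (t : T) => g t (v t))
    (by fun_prop) (by fun_prop)

lemma IsDependencyNbhd.indepFun {nb : κ → Finset κ} {U : κ → Ω → E}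
    (h : IsDependencyNbhd P nb U) {k l : κ} (hl : l ∉ nb k) : IndepFun (U k) (U l) P := by
  have := h {k} {l} (by simpa using hl)
  exact this.comp (φ := fun v : ({k} : Finset κ) → E => v ⟨k, by simp⟩)
    (ψ := fun v : ({l} : Finset κ) → E => v ⟨l, by simp⟩)
    (by fun_prop) (by fun_prop)

/-- The factorization is needed for `S` with two elements, which is why dependency neighbourhoods
are defined through sets of indices and not pairwise. -/
lemma IsDependencyNbhd.integral_mul_cis {nb : κ → Finset κ} {U : κ → Ω → ℝ}
    (h : IsDependencyNbhd P nb U) (hU : ∀ k, AEMeasurable (U k) P) {S T : Finset κ}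
    (hST : ∀ s ∈ S, Disjoint (nb s) T) {f : (S → ℝ) → ℂ} (hf : Measurable f) (t : ℝ) :
    ∫ ω, f (fun s => U s ω) * cis (t * ∑ l ∈ T, U l ω) ∂P =
      (∫ ω, f (fun s => U s ω) ∂P) * ∫ ω, cis (t * ∑ l ∈ T, U l ω) ∂P := by
  have hm : Measurable fun v : T → ℝ => cis (t * ∑ l, v l) := by fun_prop
  have hi := (h S T hST).comp hf hm
  have e : ∀ ω, ∑ l ∈ T, U l ω = ∑ l : T, U l ω := fun ω => (Finset.sum_coe_sort T _).symm
  simp only [e]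
  have hS : AEMeasurable (fun ω (s : S) => U s ω) P := aemeasurable_pi_lambda _ fun s => hU _
  have hT : AEMeasurable (fun ω (s : T) => U s ω) P := aemeasurable_pi_lambda _ fun s => hU _
  exact hi.integral_fun_mul_eq_mul_integral (hf.comp_aemeasurable hS).aestronglyMeasurable
    (hm.comp_aemeasurable hT).aestronglyMeasurable

lemma norm_integral_sub_le_of_norm_sub_le [IsProbabilityMeasure P] {f g : Ω → ℂ}
    (hf : Integrable f P) (hg : Integrable g P) {C : ℝ} (h : ∀ ω, ‖f ω - g ω‖ ≤ C) :
    ‖∫ ω, f ω ∂P - ∫ ω, g ω ∂P‖ ≤ C := by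
  rw [← integral_sub hf hg]
  simpa using norm_integral_le_of_norm_le_const (μ := P) (Eventually.of_forall h)

lemma abs_sum_le_of_card_le {U : κ → ℝ} {M : ℝ} (hU : ∀ k, |U k| ≤ M) (hM : 0 ≤ M)
    {s : Finset κ} {K : ℝ} (hs : (s.card : ℝ) ≤ K) : |∑ k ∈ s, U k| ≤ K * M := by
  calc |∑ k ∈ s, U k| ≤ ∑ k ∈ s, |U k| := Finset.abs_sum_le_sum_abs _ _
    _ ≤ ∑ k ∈ s, M := Finset.sum_le_sum fun k _ => hU k
    _ = s.card * M := by simp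
    _ ≤ K * M := by gcongr

/-- Stein-type expansion of `E U_k e^{itW}` for a bounded centred family with dependency
neighbourhoods. -/
lemma IsDependencyNbhd.norm_integral_mul_cis_sub_le [Fintype κ] [DecidableEq κ]
    [IsProbabilityMeasure P] {nb : κ → Finset κ} {U : κ → Ω → ℝ}
    (h : IsDependencyNbhd P nb U) (hU : ∀ k, AEMeasurable (U k) P) {M K : ℝ} (hM : 0 ≤ M)
    (hb : ∀ k ω, |U k ω| ≤ M) (h0 : ∀ k, ∫ ω, U k ω ∂P = 0)
    (hK : ∀ k, ((nb k).card : ℝ) ≤ K) (t : ℝ) (k : κ) :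
    ‖∫ ω, (U k ω : ℂ) * cis (t * ∑ l, U l ω) ∂P -
      t * Complex.I * (∑ j ∈ nb k, ∫ ω, U k ω * U j ω ∂P : ℝ) * ∫ ω, cis (t * ∑ l, U l ω) ∂P‖ ≤
      5 * K ^ 2 * M ^ 3 * t ^ 2 := by
  have hK0 : 0 ≤ K := (Nat.cast_nonneg _).trans (hK k)
  have key : ∀ j ∈ nb k, ‖∫ ω, ((U k ω * U j ω : ℝ) : ℂ) * cis (t * ∑ l ∈ (nb k)ᶜ, U l ω) ∂P -
      (∫ ω, U k ω * U j ω ∂P : ℝ) * ∫ ω, cis (t * ∑ l, U l ω) ∂P‖ ≤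
      3 * K * M ^ 3 * |t| := by
    intro j hj
    -- Deleting `nb j` too makes `U k * U j` independent of the exponential. This moves the exponent
    -- by at most `|t| K M`; restoring both neighbourhoods after the factorization moves it by at
    -- most `2 |t| K M`. Hence the constant 3.
    set T : Finset κ := (nb k ∪ nb j)ᶜ with hT
    have e := h.integral_mul_cis hU (S := {k, j}) (T := T) (by
      intro s hs
      refine Disjoint.mono_left (b := nb k ∪ nb j) ?_ disjoint_compl_right
      rcases Finset.mem_insert.1 hs with rfl | hs
      · exact Finset.subset_union_left
      · rw [Finset.mem_singleton.1 hs]; exact Finset.subset_union_right)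
      (f := fun v => ((v ⟨k, by simp⟩ * v ⟨j, by simp⟩ : ℝ) : ℂ)) (by fun_prop) t
    simp only at e
    have b2 : ∀ ω, |U k ω * U j ω| ≤ M ^ 2 := fun ω => by
      rw [abs_mul, sq]; exact mul_le_mul (hb _ _) (hb _ _) (abs_nonneg _) hM
    have e1 : ‖∫ ω, ((U k ω * U j ω : ℝ) : ℂ) * cis (t * ∑ l ∈ (nb k)ᶜ, U l ω) ∂P -
        ∫ ω, ((U k ω * U j ω : ℝ) : ℂ) * cis (t * ∑ l ∈ T, U l ω) ∂P‖ ≤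
        M ^ 2 * (|t| * (K * M)) := by
      apply norm_integral_sub_le_of_norm_sub_le
      · refine Integrable.of_bound (by fun_prop) (M ^ 2) (Eventually.of_forall fun ω => ?_)
        rw [norm_mul, norm_cis, Complex.norm_real, mul_one]; exact b2 ω
      · refine Integrable.of_bound (by fun_prop) (M ^ 2) (Eventually.of_forall fun ω => ?_)
        rw [norm_mul, norm_cis, Complex.norm_real, mul_one]; exact b2 ω
      · intro ω
        rw [← mul_sub, norm_mul, Complex.norm_real]
        refine mul_le_mul (b2 ω) ?_ (norm_nonneg _) (by positivity)
        refine (norm_cis_sub_cis_le _ _).trans ?_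
        rw [← mul_sub, abs_mul]
        gcongr
        have hsub : T ⊆ (nb k)ᶜ := by
          rw [hT]; exact Finset.compl_subset_compl.2 Finset.subset_union_left
        rw [← Finset.sum_sdiff hsub, add_sub_cancel_right]
        apply abs_sum_le_of_card_le (hb · ω) hM
        refine le_trans ?_ (hK j)
        exact_mod_cast Finset.card_le_card (by
          intro l hl; simp [hT] at hl; tauto)
    have e2 : ‖∫ ω, cis (t * ∑ l ∈ T, U l ω) ∂P - ∫ ω, cis (t * ∑ l, U l ω) ∂P‖ ≤
        |t| * ((2 * K) * M) := by
      apply norm_integral_sub_le_of_norm_sub_le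
      · exact Integrable.of_bound (by fun_prop) 1 (Eventually.of_forall fun ω => (norm_cis _).le)
      · exact Integrable.of_bound (by fun_prop) 1 (Eventually.of_forall fun ω => (norm_cis _).le)
      · intro ω
        refine (norm_cis_sub_cis_le _ _).trans ?_
        rw [← mul_sub, abs_mul]
        gcongr
        rw [← Finset.sum_sdiff (Finset.subset_univ T), sub_add_cancel_right, abs_neg]
        apply abs_sum_le_of_card_le (hb · ω) hM
        have : ((nb k ∪ nb j).card : ℝ) ≤ (nb k).card + (nb j).card := by
          exact_mod_cast Finset.card_union_le _ _
        have e3 : Finset.univ \ T = nb k ∪ nb j := by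
          rw [hT, ← Finset.compl_eq_univ_sdiff, compl_compl]
        rw [e3]
        linarith [hK k, hK j]
    have e4 : |∫ ω, U k ω * U j ω ∂P| ≤ M ^ 2 := by
      have := norm_integral_le_of_norm_le_const (μ := P) (f := fun ω => U k ω * U j ω)
        (Eventually.of_forall b2)
      rwa [Real.norm_eq_abs, probReal_univ, mul_one] at this
    rw [integral_complex_ofReal] at e
    rw [e] at e1
    calc _ = ‖(∫ ω, ((U k ω * U j ω : ℝ) : ℂ) * cis (t * ∑ l ∈ (nb k)ᶜ, U l ω) ∂P -
          (∫ ω, U k ω * U j ω ∂P : ℝ) * ∫ ω, cis (t * ∑ l ∈ T, U l ω) ∂P) +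
          (∫ ω, U k ω * U j ω ∂P : ℝ) * (∫ ω, cis (t * ∑ l ∈ T, U l ω) ∂P -
            ∫ ω, cis (t * ∑ l, U l ω) ∂P)‖ := by congr 1; ring
      _ ≤ M ^ 2 * (|t| * (K * M)) + M ^ 2 * (|t| * ((2 * K) * M)) := by
        refine (norm_add_le _ _).trans (add_le_add e1 ?_)
        rw [norm_mul, Complex.norm_real]
        exact mul_le_mul e4 e2 (norm_nonneg _) (by positivity)
      _ = _ := by ring
  -- The zeroth-order term vanishes: `U k` is centred and independent of the sum outside `nb k`.
  have ek : ∫ ω, (U k ω : ℂ) * cis (t * ∑ l ∈ (nb k)ᶜ, U l ω) ∂P = 0 := by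
    have e := h.integral_mul_cis hU (S := {k}) (T := (nb k)ᶜ) (by
      intro s hs
      rw [Finset.mem_singleton.1 hs]
      exact disjoint_compl_right)
      (f := fun v => ((v ⟨k, by simp⟩ : ℝ) : ℂ)) (by fun_prop) t
    simp only at e
    rw [e, integral_complex_ofReal, h0]; simp
  have hint : ∀ j, Integrable
      (fun ω => ((U k ω * U j ω : ℝ) : ℂ) * cis (t * ∑ l ∈ (nb k)ᶜ, U l ω)) P := by
    intro j
    refine Integrable.of_bound (by fun_prop) (M ^ 2) (Eventually.of_forall fun ω => ?_)
    rw [norm_mul, norm_cis, Complex.norm_real, mul_one, norm_mul, sq]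
    exact mul_le_mul (hb _ _) (hb _ _) (abs_nonneg _) hM
  have hint1 : ∀ s : Finset κ, Integrable
      (fun ω => (U k ω : ℂ) * cis (t * ∑ l ∈ s, U l ω)) P := by
    intro s
    refine Integrable.of_bound (by fun_prop) M (Eventually.of_forall fun ω => ?_)
    rw [norm_mul, norm_cis, Complex.norm_real, mul_one]
    exact hb _ _
  -- First-order expansion of the factor `cis` of the sum over `nb k`, whose argument is at most
  -- `|t| K M`. It contributes 2 to the final constant 5; the factorization error `key`, summed over
  -- `nb k`, contributes 3.
  have e5 : ‖∫ ω, (U k ω : ℂ) * cis (t * ∑ l, U l ω) ∂P -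
      ∫ ω, ((U k ω : ℂ) * cis (t * ∑ l ∈ (nb k)ᶜ, U l ω) +
        ∑ j ∈ nb k, t * Complex.I *
          (((U k ω * U j ω : ℝ) : ℂ) * cis (t * ∑ l ∈ (nb k)ᶜ, U l ω))) ∂P‖ ≤
      M * (2 * (|t| * (K * M)) ^ 2) := by
    apply norm_integral_sub_le_of_norm_sub_le (hint1 _)
    · exact (hint1 _).add (integrable_finsetSum _ fun j _ => (hint j).const_mul _)
    · intro ω
      have e6 : ∑ l, U l ω = ∑ l ∈ (nb k)ᶜ, U l ω + ∑ l ∈ nb k, U l ω := by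
        rw [add_comm, Finset.sum_add_sum_compl]
      have e7 : (U k ω : ℂ) * cis (t * ∑ l, U l ω) - ((U k ω : ℂ) * cis (t * ∑ l ∈ (nb k)ᶜ, U l ω) +
          ∑ j ∈ nb k, t * Complex.I *
            (((U k ω * U j ω : ℝ) : ℂ) * cis (t * ∑ l ∈ (nb k)ᶜ, U l ω))) =
          U k ω * (cis (t * ∑ l ∈ (nb k)ᶜ, U l ω) * (cis (t * ∑ l ∈ nb k, U l ω) - 1 -
            (t * ∑ l ∈ nb k, U l ω : ℝ) * Complex.I)) := by
        rw [e6, mul_add, cis_add, ← Finset.mul_sum, ← Finset.sum_mul]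
        push_cast
        rw [← Finset.mul_sum]
        ring
      rw [e7, norm_mul, norm_mul, norm_cis, one_mul, Complex.norm_real]
      refine mul_le_mul (hb _ _) ((norm_cis_sub_one_sub_le _).trans ?_) (norm_nonneg _) hM
      rw [← sq_abs (t * _), abs_mul]
      gcongr
      exact abs_sum_le_of_card_le (hb · ω) hM (hK k)
  rw [integral_add (hint1 _) (integrable_finsetSum _ fun j _ => (hint j).const_mul _), ek,
    zero_add, integral_finsetSum _ fun j _ => (hint j).const_mul _] at e5
  simp only [integral_const_mul] at e5
  rw [← Finset.mul_sum] at e5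
  calc _ = ‖(∫ ω, (U k ω : ℂ) * cis (t * ∑ l, U l ω) ∂P - t * Complex.I *
        ∑ j ∈ nb k, ∫ ω, ((U k ω * U j ω : ℝ) : ℂ) * cis (t * ∑ l ∈ (nb k)ᶜ, U l ω) ∂P) +
        t * Complex.I * ∑ j ∈ nb k,
          (∫ ω, ((U k ω * U j ω : ℝ) : ℂ) * cis (t * ∑ l ∈ (nb k)ᶜ, U l ω) ∂P -
          (∫ ω, U k ω * U j ω ∂P : ℝ) * ∫ ω, cis (t * ∑ l, U l ω) ∂P)‖ := by
        rw [Finset.sum_sub_distrib, ← Finset.sum_mul]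
        push_cast
        congr 1; ring
    _ ≤ M * (2 * (|t| * (K * M)) ^ 2) + |t| * (K * (3 * K * M ^ 3 * |t|)) := by
      refine (norm_add_le _ _).trans (add_le_add e5 ?_)
      rw [norm_mul, norm_mul, Complex.norm_I, mul_one, Complex.norm_real, Real.norm_eq_abs]
      gcongr
      refine (norm_sum_le _ _).trans ((Finset.sum_le_sum key).trans ?_)
      rw [Finset.sum_const, nsmul_eq_mul]
      gcongr
      exact hK k
    _ = 5 * K ^ 2 * M ^ 3 * t ^ 2 := by rw [← sq_abs t]; ring

/-- Quantitative central limit theorem for a bounded centred family with dependency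
neighbourhoods. -/
theorem IsDependencyNbhd.norm_integral_cis_sub_exp_le [Fintype κ] [DecidableEq κ]
    [IsProbabilityMeasure P] {nb : κ → Finset κ} {U : κ → Ω → ℝ}
    (h : IsDependencyNbhd P nb U) (hU : ∀ k, AEMeasurable (U k) P) {M K : ℝ} (hM : 0 ≤ M)
    (hb : ∀ k ω, |U k ω| ≤ M) (h0 : ∀ k, ∫ ω, U k ω ∂P = 0)
    (hK : ∀ k, ((nb k).card : ℝ) ≤ K) :
    ‖∫ ω, cis (∑ k, U k ω) ∂P - Real.exp (-Var[fun ω => ∑ k, U k ω; P] / 2)‖ ≤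
      Fintype.card κ * (5 * K ^ 2 * M ^ 3) := by
  have hL : ∀ k, MemLp (U k) 2 P := fun k =>
    MemLp.of_bound (hU k).aestronglyMeasurable M (Eventually.of_forall (hb k))
  set W : Ω → ℝ := fun ω => ∑ k, U k ω with hW
  set v : ℝ := Var[W; P] with hv
  -- Covariances vanish off the neighbourhoods, so the second moments left by the expansion add up
  -- to exactly the variance.
  have hvar : v = ∑ k, ∑ j ∈ nb k, ∫ ω, U k ω * U j ω ∂P := by
    rw [hv, hW, variance_fun_sum hL]
    refine Finset.sum_congr rfl fun k _ => ?_
    rw [← Finset.sum_subset (Finset.subset_univ (nb k))]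
    · refine Finset.sum_congr rfl fun j _ => ?_
      rw [covariance_eq_sub (hL k) (hL j), h0]; simp
    · intro j _ hj
      exact (h.indepFun hj).covariance_eq_zero (hL k) (hL j)
  have hv0 : 0 ≤ v := variance_nonneg _ _
  set φ : ℝ → ℂ := fun t => ∫ ω, cis (t * W ω) ∂P with hφ
  have hWm : AEMeasurable W P := by fun_prop
  have hWb : ∀ ω, |W ω| ≤ Fintype.card κ * M := fun ω =>
    abs_sum_le_of_card_le (hb · ω) hM (by simp)
  have hderiv : ∀ t, HasDerivAt φ (∫ ω, Complex.I * (W ω * cis (t * W ω)) ∂P) t := by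
    intro t
    refine (hasDerivAt_integral_of_dominated_loc_of_deriv_le (F := fun t ω => cis (t * W ω))
      (F' := fun t ω => Complex.I * (W ω * cis (t * W ω))) (s := Set.univ)
      (bound := fun _ => Fintype.card κ * M) univ_mem (Eventually.of_forall fun t => by fun_prop)
      (Integrable.of_bound (by fun_prop) 1 (Eventually.of_forall fun ω => (norm_cis _).le))
      (by fun_prop) ?_ (integrable_const _) ?_).2
    · refine Eventually.of_forall fun ω t _ => ?_
      rw [norm_mul, norm_mul, norm_cis, Complex.norm_I, one_mul, mul_one, Complex.norm_real]
      exact hWb ω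
    · refine Eventually.of_forall fun ω t _ => ?_
      have h1 : HasDerivAt (fun t : ℝ => ((t * W ω : ℝ) : ℂ) * Complex.I)
          (((1 * W ω : ℝ) : ℂ) * Complex.I) t :=
        (((hasDerivAt_id t).mul_const (W ω)).ofReal_comp).mul_const _
      have h2 := h1.cexp
      unfold cis
      exact h2.congr_deriv (by push_cast; ring)
  -- The differential equation `φ' = -t v φ` up to an error, obtained by summing the expansion over
  -- `k`.
  have hbd : ∀ t, ‖(∫ ω, Complex.I * (W ω * cis (t * W ω)) ∂P) + t * v * φ t‖ ≤
      Fintype.card κ * (5 * K ^ 2 * M ^ 3 * t ^ 2) := by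
    intro t
    have hint : ∀ k, Integrable (fun ω => (U k ω : ℂ) * cis (t * W ω)) P := by
      intro k
      refine Integrable.of_bound (by fun_prop) M (Eventually.of_forall fun ω => ?_)
      rw [norm_mul, norm_cis, Complex.norm_real, mul_one]
      exact hb _ _
    have e1 : ∫ ω, Complex.I * (W ω * cis (t * W ω)) ∂P =
        Complex.I * ∑ k, ∫ ω, (U k ω : ℂ) * cis (t * W ω) ∂P := by
      rw [integral_const_mul, ← integral_finsetSum _ fun k _ => hint k]
      congr 2
      ext ω
      rw [← Finset.sum_mul, hW]; push_cast; rfl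
    have e2 : (∫ ω, Complex.I * (W ω * cis (t * W ω)) ∂P) + t * v * φ t =
        Complex.I * ∑ k, (∫ ω, (U k ω : ℂ) * cis (t * W ω) ∂P -
          t * Complex.I * (∑ j ∈ nb k, ∫ ω, U k ω * U j ω ∂P : ℝ) * φ t) := by
      rw [e1, Finset.sum_sub_distrib, ← Finset.sum_mul, ← Finset.mul_sum, hvar]
      push_cast
      linear_combination (t * (∑ k, ∑ j ∈ nb k, ((∫ ω, U k ω * U j ω ∂P : ℝ) : ℂ)) * φ t) *
        Complex.I_sq
    rw [e2, norm_mul, Complex.norm_I, one_mul]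
    refine (norm_sum_le _ _).trans ((Finset.sum_le_sum fun k _ =>
      h.norm_integral_mul_cis_sub_le hU hM hb h0 hK t k).trans ?_)
    simp
  -- The integrating factor is normalized to be 1 at `t = 1` and `e^{-v/2}` at `t = 0`; it is at
  -- most 1 between, so the error is not amplified.
  have hg : ∀ t, HasDerivAt (fun t : ℝ => φ t * (Real.exp (v * (t ^ 2 - 1) / 2) : ℂ))
      (((∫ ω, Complex.I * (W ω * cis (t * W ω)) ∂P) + t * v * φ t) *
        (Real.exp (v * (t ^ 2 - 1) / 2) : ℂ)) t := by
    intro t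
    have h1 : HasDerivAt (fun t : ℝ => v * (t ^ 2 - 1) / 2) (v * t) t := by
      have := ((((hasDerivAt_id t).pow 2).sub_const 1).const_mul v).div_const 2
      exact this.congr_deriv (by simp; ring)
    have h2 := (hderiv t).mul h1.exp.ofReal_comp
    exact h2.congr_deriv (by push_cast; ring)
  have := norm_image_sub_le_of_norm_deriv_le_segment_01'
    (C := Fintype.card κ * (5 * K ^ 2 * M ^ 3)) (fun t _ => (hg t).hasDerivWithinAt) (by
      intro t ht
      rw [norm_mul, Complex.norm_real, Real.norm_eq_abs, Real.abs_exp]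
      have ht2 : t ^ 2 ≤ 1 := by nlinarith [ht.1, ht.2]
      have h1 : Real.exp (v * (t ^ 2 - 1) / 2) ≤ 1 := by
        rw [Real.exp_le_one_iff]; nlinarith
      calc _ ≤ Fintype.card κ * (5 * K ^ 2 * M ^ 3 * 1) * 1 := by
            refine mul_le_mul ((hbd t).trans ?_) h1 (Real.exp_nonneg _) (by positivity)
            gcongr
        _ = _ := by ring)
  have e1 : φ 1 = ∫ ω, cis (∑ k, U k ω) ∂P := by simp only [hφ, hW, one_mul]
  have e0 : φ 0 = 1 := by simp [hφ, cis]
  rwa [e1, e0, show v * (1 ^ 2 - 1) / 2 = 0 by ring, show v * (0 ^ 2 - 1) / 2 = -v / 2 by ring,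
    Real.exp_zero, Complex.ofReal_one, mul_one, one_mul] at this

end

end BandCLT

/-! ### Truncation: from bounded to square-integrable summands -/

namespace BandCLT

noncomputable section

variable {Ω κ : Type*} [MeasurableSpace Ω] {P : Measure Ω}

/-- Nonnegativity of the variances of `δ X + Y` and `δ X - Y`. The weight `δ` pays off when `Y` has
much smaller variance than `X`. -/
lemma abs_covariance_le [IsProbabilityMeasure P] {X Y : Ω → ℝ} (hX : MemLp X 2 P)
    (hY : MemLp Y 2 P) {δ : ℝ} (hδ : 0 < δ) :
    |cov[X, Y; P]| ≤ (δ * Var[X; P] + Var[Y; P] / δ) / 2 := by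
  have h1 := variance_nonneg (fun ω => δ * X ω + Y ω) P
  have h2 := variance_nonneg (fun ω => δ * X ω - Y ω) P
  rw [variance_fun_add (hX.const_mul δ) hY, variance_const_mul, covariance_const_mul_left] at h1
  rw [variance_fun_sub (hX.const_mul δ) hY, variance_const_mul, covariance_const_mul_left] at h2
  have e : δ * ((δ * Var[X; P] + Var[Y; P] / δ) / 2) = (δ ^ 2 * Var[X; P] + Var[Y; P]) / 2 := by
    field_simp
  refine abs_le.2 ⟨?_, ?_⟩
  · refine le_of_mul_le_mul_left ?_ hδ
    rw [mul_neg, e]; linarith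
  · refine le_of_mul_le_mul_left ?_ hδ
    rw [e]; linarith

lemma IsDependencyNbhd.variance_sum_le [Fintype κ] [IsProbabilityMeasure P]
    {nb : κ → Finset κ} {U : κ → Ω → ℝ} (h : IsDependencyNbhd P nb U)
    (hU : ∀ k, MemLp (U k) 2 P) {K v : ℝ} (hK : ∀ k, ((nb k).card : ℝ) ≤ K)
    (hv : ∀ k, Var[U k; P] ≤ v) :
    Var[fun ω => ∑ k, U k ω; P] ≤ Fintype.card κ * (K * v) := by
  rw [variance_fun_sum hU]
  calc ∑ k, ∑ j, cov[U k, U j; P] ≤ ∑ _k : κ, K * v := by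
        refine Finset.sum_le_sum fun k _ => ?_
        rw [← Finset.sum_subset (Finset.subset_univ (nb k)) fun j _ hj =>
          (h.indepFun hj).covariance_eq_zero (hU k) (hU j)]
        have hv0 : 0 ≤ v := (variance_nonneg _ _).trans (hv k)
        calc ∑ j ∈ nb k, cov[U k, U j; P] ≤ ∑ j ∈ nb k, v := by
              refine Finset.sum_le_sum fun j _ => (le_abs_self _).trans ?_
              have := abs_covariance_le (hU k) (hU j) one_pos
              linarith [hv k, hv j]
          _ = (nb k).card * v := by simp
          _ ≤ K * v := by gcongr; exact hK k
    _ = _ := by simp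

/-- Truncation of a real number at level `M`. -/
def trunc (M x : ℝ) : ℝ := if |x| ≤ M then x else 0

@[fun_prop]
lemma measurable_trunc (M : ℝ) : Measurable (trunc M) :=
  Measurable.ite (measurableSet_le (by fun_prop) (by fun_prop)) measurable_id measurable_const

lemma abs_trunc_le {M : ℝ} (hM : 0 ≤ M) (x : ℝ) : |trunc M x| ≤ M := by
  unfold trunc; split_ifs with h
  · exact h
  · simpa using hM

lemma sq_le_trunc (M x : ℝ) : x ^ 2 ≤ M ^ 2 + (x - trunc M x) ^ 2 := by
  unfold trunc; split_ifs with h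
  · have := sq_le_sq' (abs_le.1 h).1 (abs_le.1 h).2
    nlinarith [sq_nonneg (x - x)]
  · nlinarith [sq_nonneg M]

/-- Factoring out the larger exponential, which is at most 1, leaves `1 - e^{-u/2} ≤ u/2`. -/
lemma abs_exp_sub_exp_le {a b : ℝ} (ha : 0 ≤ a) (hb : 0 ≤ b) :
    |Real.exp (-a / 2) - Real.exp (-b / 2)| ≤ |a - b| / 2 := by
  have key : ∀ {a b : ℝ}, 0 ≤ a → a ≤ b →
      Real.exp (-a / 2) - Real.exp (-b / 2) ≤ (b - a) / 2 := by
    intro a b ha hab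
    have e : Real.exp (-b / 2) = Real.exp (-a / 2) * Real.exp (-(b - a) / 2) := by
      rw [← Real.exp_add]; ring_nf
    have h1 := Real.add_one_le_exp (-(b - a) / 2)
    have h2 : Real.exp (-a / 2) ≤ 1 := Real.exp_le_one_iff.2 (by linarith)
    have h3 := Real.exp_pos (-a / 2)
    rw [e]
    nlinarith
  rcases le_total a b with hab | hab
  · rw [abs_of_nonneg (sub_nonneg.2 (Real.exp_le_exp.2 (by linarith))), abs_of_nonpos (by linarith)]
    linarith [key ha hab]
  · rw [abs_of_nonpos (sub_nonpos.2 (Real.exp_le_exp.2 (by linarith))), abs_of_nonneg (by linarith)]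
    linarith [key hb hab]

/-- Quantitative central limit theorem for square-integrable families with dependency
neighbourhoods. -/
theorem IsDependencyNbhd.norm_integral_cis_sub_exp_le_of_trunc [Fintype κ] [DecidableEq κ]
    [IsProbabilityMeasure P] {nb : κ → Finset κ} {T : κ → Ω → ℝ}
    (h : IsDependencyNbhd P nb T) (hT : ∀ k, MemLp (T k) 2 P) {K v M η c : ℝ} (hM : 0 ≤ M)
    (hK0 : 0 ≤ K) (hv0 : 0 ≤ v)
    (hη : 0 < η) (hη1 : η ≤ 1) (hc : 0 ≤ c) (hcd : Fintype.card κ * c ^ 2 ≤ 1)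
    (hK : ∀ k, ((nb k).card : ℝ) ≤ K) (hv : ∀ k, Var[T k; P] ≤ v)
    (hR : ∀ k, ∫ ω, (T k ω - trunc M (T k ω)) ^ 2 ∂P ≤ η ^ 2) :
    ‖∫ ω, cis (∑ k, c * (T k ω - ∫ ω', T k ω' ∂P)) ∂P -
      Real.exp (-Var[fun ω => ∑ k, c * (T k ω - ∫ ω', T k ω' ∂P); P] / 2)‖ ≤
      η * ((1 + K) * (v + 3)) + 40 * K ^ 2 * M ^ 3 * c := by
  have hTm : ∀ k, AEMeasurable (T k) P := fun k => (hT k).aemeasurable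
  have hTt : ∀ k, MemLp (fun ω => trunc M (T k ω)) 2 P := fun k =>
    MemLp.of_bound ((measurable_trunc M).comp_aemeasurable (hTm k)).aestronglyMeasurable M
      (Eventually.of_forall fun ω => abs_trunc_le hM _)
  have hTi : ∀ k, Integrable (T k) P := fun k => (hT k).integrable one_le_two
  have hTti : ∀ k, Integrable (fun ω => trunc M (T k ω)) P := fun k =>
    (hTt k).integrable one_le_two
  set W : Ω → ℝ := fun ω => ∑ k, c * (T k ω - ∫ ω', T k ω' ∂P) with hW
  set A : Ω → ℝ := fun ω => ∑ k, c * (trunc M (T k ω) - ∫ ω', trunc M (T k ω') ∂P) with hA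
  set r : κ → ℝ := fun k => ∫ ω, (T k ω - trunc M (T k ω)) ∂P with hr
  set Q : Ω → ℝ := fun ω => ∑ k, c * ((T k ω - trunc M (T k ω)) - r k) with hQ
  have hWL : MemLp W 2 P := memLp_finsetSum _ fun k _ =>
    ((hT k).sub (memLp_const _)).const_mul c
  have hAL : MemLp A 2 P := memLp_finsetSum _ fun k _ =>
    ((hTt k).sub (memLp_const _)).const_mul c
  have hQL : MemLp Q 2 P := memLp_finsetSum _ fun k _ =>
    (((hT k).sub (hTt k)).sub (memLp_const _)).const_mul c
  have hWAQ : ∀ ω, A ω = W ω - Q ω := by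
    intro ω
    simp only [hA, hW, hQ, ← Finset.sum_sub_distrib]
    refine Finset.sum_congr rfl fun k _ => ?_
    rw [hr]; simp only; rw [integral_sub (hTi k) (hTti k)]; ring
  -- variances
  have hVQ : Var[Q; P] ≤ K * η ^ 2 := by
    have hdep : IsDependencyNbhd P nb (fun k ω => c * ((T k ω - trunc M (T k ω)) - r k)) :=
      h.comp (g := fun k x => c * ((x - trunc M x) - r k)) (by fun_prop)
    refine (hdep.variance_sum_le (v := c ^ 2 * η ^ 2) (fun k =>
      (((hT k).sub (hTt k)).sub (memLp_const _)).const_mul c) hK ?_).trans ?_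
    · intro k
      rw [variance_const_mul]
      gcongr
      rw [variance_sub_const (by fun_prop)]
      exact (variance_le_expectation_sq (by fun_prop)).trans (hR k)
    · have : 0 ≤ K * η ^ 2 := by positivity
      nlinarith
  have hVW : Var[W; P] ≤ K * v := by
    have hdep : IsDependencyNbhd P nb (fun k ω => c * (T k ω - ∫ ω', T k ω' ∂P)) :=
      h.comp (g := fun k x => c * (x - ∫ ω', T k ω' ∂P)) (by fun_prop)
    refine (hdep.variance_sum_le (v := c ^ 2 * v) (fun k =>
      ((hT k).sub (memLp_const _)).const_mul c) hK ?_).trans ?_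
    · intro k
      rw [variance_const_mul]
      gcongr
      rw [variance_sub_const (by fun_prop)]
      exact hv k
    · have : 0 ≤ K * v := by positivity
      nlinarith
  have hVA : Var[A; P] = Var[W; P] - 2 * cov[W, Q; P] + Var[Q; P] := by
    rw [← variance_fun_sub hWL hQL]
    congr 1; ext ω; exact hWAQ ω
  have hη2 : η ^ 2 ≤ η := by nlinarith
  -- `Var Q` is of order `η ^ 2` while `Var W` is only bounded, so weight `η` in `abs_covariance_le`
  -- makes the cross term of order `η`.
  have hdiff : |Var[A; P] - Var[W; P]| ≤ η * (K * (v + 2)) := by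
    have h1 := abs_covariance_le hWL hQL hη
    have h2 : Var[Q; P] / η ≤ K * η := by
      rw [div_le_iff₀ hη]; nlinarith
    have h3 : Var[Q; P] ≤ K * η := hVQ.trans (by gcongr)
    have h4 : η * Var[W; P] ≤ η * (K * v) := by gcongr
    rw [hVA]
    have h5 := abs_le.1 h1
    have := variance_nonneg Q P
    rw [abs_le]
    constructor <;> nlinarith
  -- the bounded part
  have hmain : ‖∫ ω, cis (A ω) ∂P - Real.exp (-Var[A; P] / 2)‖ ≤ 40 * K ^ 2 * M ^ 3 * c := by
    have hdep : IsDependencyNbhd P nb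
        (fun k ω => c * (trunc M (T k ω) - ∫ ω', trunc M (T k ω') ∂P)) :=
      h.comp (g := fun k x => c * (trunc M x - ∫ ω', trunc M (T k ω') ∂P)) (by fun_prop)
    refine (hdep.norm_integral_cis_sub_exp_le (M := c * (2 * M)) (by fun_prop) (by positivity)
      ?_ ?_ hK).trans ?_
    · intro k ω
      rw [abs_mul, abs_of_nonneg hc]
      gcongr
      have h1 : |∫ ω', trunc M (T k ω') ∂P| ≤ M := by
        have := norm_integral_le_of_norm_le_const (μ := P) (f := fun ω => trunc M (T k ω))
          (Eventually.of_forall fun ω => abs_trunc_le hM _)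
        rwa [Real.norm_eq_abs, probReal_univ, mul_one] at this
      have h2 := abs_trunc_le hM (T k ω)
      have := abs_sub (trunc M (T k ω)) (∫ ω', trunc M (T k ω') ∂P)
      linarith
    · intro k
      rw [integral_const_mul, integral_sub (hTti k) (integrable_const _)]
      simp
    -- Of the three factors `c` in the cube, two absorb the number of summands and the third keeps
    -- the error small.
    · calc (Fintype.card κ : ℝ) * (5 * K ^ 2 * (c * (2 * M)) ^ 3) =
          (Fintype.card κ * c ^ 2) * (40 * K ^ 2 * M ^ 3 * c) := by ring
        _ ≤ 1 * (40 * K ^ 2 * M ^ 3 * c) := by gcongr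
        _ = _ := one_mul _
  -- the remainder
  have hrem : ‖∫ ω, cis (W ω) ∂P - ∫ ω, cis (A ω) ∂P‖ ≤ η * (1 + K) / 2 := by
    have hi : ∀ V : Ω → ℝ, AEMeasurable V P → Integrable (fun ω => cis (V ω)) P := fun V hV =>
      Integrable.of_bound (by fun_prop) 1 (Eventually.of_forall fun ω => (norm_cis _).le)
    rw [← integral_sub (hi _ hWL.aemeasurable) (hi _ hAL.aemeasurable)]
    have hQ0 : ∫ ω, Q ω ∂P = 0 := by
      rw [hQ, integral_finsetSum]
      · refine Finset.sum_eq_zero fun k _ => ?_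
        have hi2 : Integrable (fun ω => T k ω - trunc M (T k ω)) P := (hTi k).sub (hTti k)
        rw [integral_const_mul, integral_sub hi2 (integrable_const _)]
        simp [hr]
      · exact fun k _ => (((hTi k).sub (hTti k)).sub (integrable_const _)).const_mul _
    have hQv : ∫ ω, Q ω ^ 2 ∂P = Var[Q; P] := by
      rw [variance_eq_sub hQL, hQ0]; simp
    calc ‖∫ ω, (cis (W ω) - cis (A ω)) ∂P‖ ≤ ∫ ω, (η + Q ω ^ 2 / η) / 2 ∂P := by
          refine norm_integral_le_of_norm_le
            (((integrable_const _).add (hQL.integrable_sq.div_const _)).div_const _)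
            (Eventually.of_forall fun ω => (norm_cis_sub_cis_le _ _).trans ?_)
          rw [hWAQ, sub_sub_cancel]
          -- Completing the square gives `|Q| ≤ (η + Q²/η)/2`, which trades the first moment of `Q`
          -- for its variance.
          have e : (η + Q ω ^ 2 / η) / 2 - |Q ω| = (η - |Q ω|) ^ 2 / (2 * η) := by
            rw [← sq_abs (Q ω)]; field_simp; ring
          have : 0 ≤ (η - |Q ω|) ^ 2 / (2 * η) := by positivity
          linarith
      _ = (η + Var[Q; P] / η) / 2 := by
          rw [integral_div, integral_add (integrable_const _) (hQL.integrable_sq.div_const _),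
            integral_div, hQv]
          simp
      _ ≤ η * (1 + K) / 2 := by
          have h2 : Var[Q; P] / η ≤ K * η := by
            rw [div_le_iff₀ hη]; nlinarith
          linarith
  have hexp : ‖(Real.exp (-Var[A; P] / 2) : ℂ) - Real.exp (-Var[W; P] / 2)‖ ≤
      η * (K * (v + 2)) / 2 := by
    rw [← Complex.ofReal_sub, Complex.norm_real, Real.norm_eq_abs]
    refine (abs_exp_sub_exp_le (variance_nonneg _ _) (variance_nonneg _ _)).trans ?_
    linarith
  calc _ = ‖(∫ ω, cis (W ω) ∂P - ∫ ω, cis (A ω) ∂P) +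
        (∫ ω, cis (A ω) ∂P - Real.exp (-Var[A; P] / 2)) +
        ((Real.exp (-Var[A; P] / 2) : ℂ) - Real.exp (-Var[W; P] / 2))‖ := by congr 1; ring
    _ ≤ η * (1 + K) / 2 + 40 * K ^ 2 * M ^ 3 * c + η * (K * (v + 2)) / 2 :=
      norm_add₃_le.trans (add_le_add (add_le_add hrem hmain) hexp)
    _ ≤ _ := by
      have : 0 ≤ η * (K * v) := by positivity
      have : 0 ≤ η * K := by positivity
      have : 0 ≤ η * v := by positivity
      nlinarith

lemma variance_le_of_trunc [IsProbabilityMeasure P] {X : Ω → ℝ} (hX : MemLp X 2 P) {M ε : ℝ}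
    (hM : 0 ≤ M) (hR : ∫ ω, (X ω - trunc M (X ω)) ^ 2 ∂P ≤ ε) : Var[X; P] ≤ M ^ 2 + ε := by
  have hm := hX.aemeasurable
  refine (variance_le_expectation_sq hX.aestronglyMeasurable).trans ?_
  have ht : MemLp (fun ω => trunc M (X ω)) 2 P :=
    MemLp.of_bound ((measurable_trunc M).comp_aemeasurable hm).aestronglyMeasurable M
      (Eventually.of_forall fun ω => abs_trunc_le hM _)
  have hi : Integrable (fun ω => (X ω - trunc M (X ω)) ^ 2) P := (hX.sub ht).integrable_sq
  calc ∫ ω, (X ^ 2) ω ∂P ≤ ∫ ω, (M ^ 2 + (X ω - trunc M (X ω)) ^ 2) ∂P :=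
        integral_mono hX.integrable_sq ((integrable_const _).add hi) fun ω => sq_le_trunc _ _
    _ = M ^ 2 + ∫ ω, (X ω - trunc M (X ω)) ^ 2 ∂P := by
        rw [integral_add (integrable_const _) hi]; simp
    _ ≤ _ := by linarith

/-- Central limit theorem for arrays with dependency neighbourhoods of bounded size and uniformly
integrable squares. -/
theorem tendsto_integral_cis_sub_exp {Ω : ℕ → Type*} [∀ d, MeasurableSpace (Ω d)]
    {P : ∀ d, Measure (Ω d)} [∀ d, IsProbabilityMeasure (P d)]
    {nb : ∀ d, Fin d → Finset (Fin d)} {T : ∀ d, Fin d → Ω d → ℝ}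
    (h : ∀ d, IsDependencyNbhd (P d) (nb d) (T d)) (hT : ∀ d k, MemLp (T d k) 2 (P d))
    {K : ℝ} (hK : ∀ d k, ((nb d k).card : ℝ) ≤ K)
    (hui : ∀ ε > 0, ∃ M : ℝ, 0 ≤ M ∧
      ∀ d k, ∫ ω, (T d k ω - trunc M (T d k ω)) ^ 2 ∂(P d) ≤ ε) :
    Tendsto (fun d : ℕ => ∫ ω, cis (∑ k, 1 / √(d : ℝ) * (T d k ω - ∫ ω', T d k ω' ∂(P d))) ∂(P d) -
      Real.exp (-Var[fun ω => ∑ k, 1 / √(d : ℝ) * (T d k ω - ∫ ω', T d k ω' ∂(P d)); P d] / 2))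
      atTop (𝓝 0) := by
  have hK0 : 0 ≤ K := (Nat.cast_nonneg _).trans (hK 1 0)
  obtain ⟨M₁, hM₁, h₁⟩ := hui 1 one_pos
  have hv : ∀ d k, Var[T d k; P d] ≤ M₁ ^ 2 + 1 := fun d k =>
    variance_le_of_trunc (hT d k) hM₁ (h₁ d k)
  set v := M₁ ^ 2 + 1
  have hv0 : 0 ≤ v := by positivity
  rw [Metric.tendsto_atTop]
  intro ε hε
  -- Order of choices: `η` from `ε`, the truncation level `M` from `η`, and only then `d` large in
  -- terms of `M`.
  set C := (1 + K) * (v + 3) with hC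
  have hC0 : 0 < C := by positivity
  set η := min 1 (ε / (2 * C)) with hη
  have hη0 : 0 < η := by positivity
  obtain ⟨M, hM, hR⟩ := hui (η ^ 2) (by positivity)
  have hlim : Tendsto (fun d : ℕ => 40 * K ^ 2 * M ^ 3 * (1 / √(d : ℝ))) atTop (𝓝 0) := by
    rw [← mul_zero (40 * K ^ 2 * M ^ 3)]
    simp only [one_div]
    exact (tendsto_inv_atTop_zero.comp (Real.tendsto_sqrt_atTop.comp
      tendsto_natCast_atTop_atTop)).const_mul _
  obtain ⟨N, hN⟩ := (hlim.eventually (gt_mem_nhds (half_pos hε))).exists_forall_of_atTop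
  refine ⟨N, fun d hd => ?_⟩
  rw [dist_zero_right]
  have hcd : (Fintype.card (Fin d) : ℝ) * (1 / √(d : ℝ)) ^ 2 ≤ 1 := by
    rw [Fintype.card_fin, div_pow, one_pow, Real.sq_sqrt (Nat.cast_nonneg _), mul_one_div]
    exact div_self_le_one _
  have hb := (h d).norm_integral_cis_sub_exp_le_of_trunc (hT d) hM hK0 hv0 hη0 (min_le_left _ _)
    (by positivity) hcd (hK d) (hv d) (hR d)
  have h2 : η * C ≤ ε / 2 := by
    calc η * C ≤ ε / (2 * C) * C := by gcongr; exact min_le_right _ _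
      _ = ε / 2 := by field_simp
  linarith [hN d hd]

end

end BandCLT

/-! ### Functions of independent variables: local dependence and uniform integrability -/

namespace BandCLT

noncomputable section

section General

variable {Ω κ ι E : Type*} [MeasurableSpace Ω] [MeasurableSpace E] {P : Measure Ω}

/-- Functions of finitely many independent variables have dependency neighbourhoods. -/
lemma isDependencyNbhd_of_iIndepFun [DecidableEq ι] {V : ι → Ω → ℝ} (hV : iIndepFun V P)
    (hVm : ∀ i, AEMeasurable (V i) P) {nb : κ → Finset κ} {N : κ → Finset ι}
    {Φ : κ → (ι → ℝ) → E} (hΦ : ∀ k, Measurable (Φ k))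
    (hdep : ∀ k v w, (∀ i ∈ N k, v i = w i) → Φ k v = Φ k w)
    (hnb : ∀ s t, t ∉ nb s → Disjoint (N s) (N t)) :
    IsDependencyNbhd P nb (fun k ω => Φ k (fun i => V i ω)) := by
  intro S T hST
  have hd : Disjoint (S.biUnion N) (T.biUnion N) := by
    rw [Finset.disjoint_biUnion_left]
    intro s hs
    rw [Finset.disjoint_biUnion_right]
    exact fun t ht => hnb s t fun h => Finset.disjoint_left.1 (hST s hs) h ht
  -- Padding by 0 outside the window is harmless, since `Φ s` reads only the coordinates in `N s`.
  have hext : ∀ R : Finset κ, Measurable fun (u : R.biUnion N → ℝ) (s : R) =>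
      Φ s (fun i => if h : i ∈ R.biUnion N then u ⟨i, h⟩ else 0) := by
    intro R
    refine measurable_pi_lambda _ fun s => (hΦ s).comp (measurable_pi_lambda _ fun i => ?_)
    by_cases h : i ∈ R.biUnion N
    · simp only [h, dite_true]; fun_prop
    · simp only [h, dite_false]; fun_prop
  have hrestr : ∀ R : Finset κ, (fun ω (s : R) => Φ s (fun i => V i ω)) =
      (fun (u : R.biUnion N → ℝ) (s : R) =>
        Φ s (fun i => if h : i ∈ R.biUnion N then u ⟨i, h⟩ else 0)) ∘
        fun ω (i : R.biUnion N) => V i ω := by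
    intro R
    ext ω s
    refine hdep _ _ _ fun i hi => ?_
    have hmem : i ∈ R.biUnion N := Finset.mem_biUnion.2 ⟨s, s.2, hi⟩
    simp only [hmem, dite_true]
  rw [hrestr S, hrestr T]
  exact (hV.indepFun_finset₀ _ _ hd hVm).comp (hext S) (hext T)

/-- Once `|x|` exceeds `2 C B`, the part `C B` of its bound is less than half of it, so `C S` must
cover the other half. -/
lemma sq_sub_trunc_le {x C G S B : ℝ} (hC : 0 ≤ C) (hx : |x| ≤ C * G) (hG : G ≤ B + S) :
    (x - trunc (2 * (C * B)) x) ^ 2 ≤ (2 * C * S) ^ 2 := by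
  unfold trunc
  split_ifs with h
  · rw [sub_self, zero_pow two_ne_zero]; exact sq_nonneg _
  · push Not at h
    rw [sub_zero, ← sq_abs x]
    have h1 : C * G ≤ C * (B + S) := by gcongr
    have h2 : |x| ≤ 2 * C * S := by linarith
    exact pow_le_pow_left₀ (abs_nonneg _) h2 2

/-- A variable dominated by finitely many squares has uniformly small truncated second moments. -/
lemma integral_sq_sub_trunc_le [IsProbabilityMeasure P] {V : ι → Ω → ℝ}
    {N : Finset ι} {L C B γ : ℝ} (hL0 : 0 ≤ L) (hL : (N.card : ℝ) ≤ L) (hC : 0 ≤ C) (hB : 0 ≤ B)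
    (hγ : 0 ≤ γ) {T : Ω → ℝ}
    (hTV : ∀ ω, |T ω| ≤ C * (1 + ∑ i ∈ N, V i ω ^ 2))
    (hVi : ∀ i, Integrable (fun ω => max (V i ω ^ 2 - B) 0 ^ 2) P)
    (hVγ : ∀ i, ∫ ω, max (V i ω ^ 2 - B) 0 ^ 2 ∂P ≤ γ) :
    ∫ ω, (T ω - trunc (2 * (C * (1 + L * B))) (T ω)) ^ 2 ∂P ≤ 4 * C ^ 2 * L ^ 2 * γ := by
  have hpt : ∀ ω, (T ω - trunc (2 * (C * (1 + L * B))) (T ω)) ^ 2 ≤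
      4 * C ^ 2 * (L * ∑ i ∈ N, max (V i ω ^ 2 - B) 0 ^ 2) := by
    intro ω
    -- The bound `1 + ∑ V²` splits into the constant `1 + L B` and the sum of the excesses of `V²`
    -- over `B`.
    refine (sq_sub_trunc_le hC (hTV ω) (S := ∑ i ∈ N, max (V i ω ^ 2 - B) 0) ?_).trans ?_
    · have h1 : ∑ i ∈ N, V i ω ^ 2 ≤ ∑ i ∈ N, (B + max (V i ω ^ 2 - B) 0) :=
        Finset.sum_le_sum fun i _ => by linarith [le_max_left (V i ω ^ 2 - B) 0]
      rw [Finset.sum_add_distrib, Finset.sum_const, nsmul_eq_mul] at h1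
      have h2 : (N.card : ℝ) * B ≤ L * B := by gcongr
      linarith
    · rw [mul_pow, mul_pow]
      have h3 := sq_sum_le_card_mul_sum_sq (s := N) (f := fun i => max (V i ω ^ 2 - B) 0)
      have h4 : (0 : ℝ) ≤ ∑ i ∈ N, max (V i ω ^ 2 - B) 0 ^ 2 := by positivity
      calc 2 ^ 2 * C ^ 2 * (∑ i ∈ N, max (V i ω ^ 2 - B) 0) ^ 2 ≤
          2 ^ 2 * C ^ 2 * (N.card * ∑ i ∈ N, max (V i ω ^ 2 - B) 0 ^ 2) := by gcongr
        _ ≤ 2 ^ 2 * C ^ 2 * (L * ∑ i ∈ N, max (V i ω ^ 2 - B) 0 ^ 2) := by gcongr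
        _ = _ := by ring
  have hi : Integrable (fun ω => ∑ i ∈ N, max (V i ω ^ 2 - B) 0 ^ 2) P :=
    integrable_finsetSum _ fun i _ => hVi i
  calc ∫ ω, (T ω - trunc (2 * (C * (1 + L * B))) (T ω)) ^ 2 ∂P ≤
      ∫ ω, 4 * C ^ 2 * (L * ∑ i ∈ N, max (V i ω ^ 2 - B) 0 ^ 2) ∂P :=
        integral_mono_of_nonneg (Eventually.of_forall fun ω => sq_nonneg _)
          ((hi.const_mul _).const_mul _) (Eventually.of_forall hpt)
    _ = 4 * C ^ 2 * (L * ∑ i ∈ N, ∫ ω, max (V i ω ^ 2 - B) 0 ^ 2 ∂P) := by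
        rw [integral_const_mul, integral_const_mul, integral_finsetSum _ fun i _ => hVi i]
    _ ≤ 4 * C ^ 2 * (L * (N.card * γ)) := by
        gcongr
        exact (Finset.sum_le_sum fun i _ => hVγ i).trans (by simp)
    _ ≤ 4 * C ^ 2 * (L * (L * γ)) := by gcongr
    _ = _ := by ring

lemma max_sq_sub_le {u B : ℝ} (hB : 0 ≤ B) : max (u ^ 2 - B) 0 ^ 2 ≤ u ^ 4 := by
  have h1 : max (u ^ 2 - B) 0 ≤ u ^ 2 := max_le (by linarith) (sq_nonneg u)
  calc max (u ^ 2 - B) 0 ^ 2 ≤ (u ^ 2) ^ 2 := pow_le_pow_left₀ (le_max_right _ _) h1 2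
    _ = u ^ 4 := by ring

lemma integrable_max_sq_sub {F : Measure ℝ} (hF : Integrable (fun u : ℝ => u ^ 4) F)
    {B : ℝ} (hB : 0 ≤ B) : Integrable (fun u : ℝ => max (u ^ 2 - B) 0 ^ 2) F :=
  hF.mono' (by fun_prop) (Eventually.of_forall fun u => by
    rw [Real.norm_eq_abs, abs_of_nonneg (sq_nonneg _)]; exact max_sq_sub_le hB)

/-- Dominated convergence with bound `u ^ 4`: the integrand vanishes at `u` once `B ≥ u ^ 2`. The
fourth moment gives uniform integrability here. -/
lemma tendsto_integral_max_sq_sub {F : Measure ℝ} (hF : Integrable (fun u : ℝ => u ^ 4) F) :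
    Tendsto (fun B : ℕ => ∫ u, max (u ^ 2 - (B : ℝ)) 0 ^ 2 ∂F) atTop (𝓝 0) := by
  rw [show 𝓝 (0 : ℝ) = 𝓝 (∫ _ : ℝ, (0 : ℝ) ∂F) by simp]
  refine tendsto_integral_of_dominated_convergence (fun u => u ^ 4) (fun B => by fun_prop) hF
    (fun B => Eventually.of_forall fun u => ?_) (Eventually.of_forall fun u => ?_)
  · rw [Real.norm_eq_abs, abs_of_nonneg (sq_nonneg _)]
    exact max_sq_sub_le (Nat.cast_nonneg B)
  · obtain ⟨N, hN⟩ := exists_nat_ge (u ^ 2)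
    refine tendsto_const_nhds.congr' ?_
    filter_upwards [eventually_ge_atTop N] with B hB
    have : u ^ 2 - (B : ℝ) ≤ 0 := by
      have : (N : ℝ) ≤ B := by exact_mod_cast hB
      linarith
    rw [max_eq_right this]; simp

end General

/-! ### Rows of band matrices as local functions of the raw variables -/

section Band

variable {n m d : ℕ}

/-- The column of a raw variable. -/
def rawCol : (Fin n × Fin d) ⊕ (Fin m × Fin d) → Fin d := Sum.elim Prod.snd Prod.snd

/-- The raw variables that row `k` of a matrix of bandwidth `r` involves. -/
def rawWindow (n m r : ℕ) (k : Fin d) : Finset ((Fin n × Fin d) ⊕ (Fin m × Fin d)) :=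
  {i | |(k : ℤ) - (rawCol i : ℤ)| < r}

lemma mem_rawWindow {n m r : ℕ} {k : Fin d} {i : (Fin n × Fin d) ⊕ (Fin m × Fin d)} :
    i ∈ rawWindow n m r k ↔ |(k : ℤ) - (rawCol i : ℤ)| < r := by
  simp [rawWindow]

/-- The indices at distance less than `r`. -/
def bandNbhd (r : ℕ) (k : Fin d) : Finset (Fin d) := {l | |(k : ℤ) - (l : ℤ)| < r}

lemma card_bandNbhd_le (r : ℕ) (k : Fin d) : (bandNbhd r k).card ≤ 2 * r := by
  have h : (bandNbhd r k).card ≤ (Finset.Ioo ((k : ℤ) - r) (k + r)).card := by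
    refine Finset.card_le_card_of_injOn (fun l => (l : ℤ)) (fun l hl => ?_) (fun a _ b _ h => ?_)
    · simp only [bandNbhd, Finset.coe_filter, Finset.mem_univ, true_and, Set.mem_ofPred_eq,
        abs_lt] at hl
      simp only [Finset.coe_Ioo, Set.mem_Ioo]
      omega
    · simpa [Fin.ext_iff] using h
  rw [Int.card_Ioo] at h
  omega

/-- A column at distance less than `r` from both `s` and `t` would put them at distance less than `2
r`. This doubling gives the dependency radius. -/
lemma disjoint_rawWindow {r : ℕ} {s t : Fin d} (h : t ∉ bandNbhd (2 * r) s) :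
    Disjoint (rawWindow n m r s) (rawWindow n m r t) := by
  rw [Finset.disjoint_left]
  intro i hs ht
  apply h
  simp only [rawWindow, bandNbhd, Finset.mem_filter, Finset.mem_univ, true_and, abs_lt] at *
  push_cast
  omega

lemma sum_rawWindow (r : ℕ) (k : Fin d) (f : (Fin n × Fin d) ⊕ (Fin m × Fin d) → ℝ) :
    ∑ i ∈ rawWindow n m r k, f i =
      ∑ p, ∑ l ∈ bandNbhd r k, f (.inl (p, l)) + ∑ q, ∑ l ∈ bandNbhd r k, f (.inr (q, l)) := by
  rw [rawWindow, Finset.sum_filter, Fintype.sum_sum_type, Fintype.sum_prod_type,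
    Fintype.sum_prod_type]
  simp only [bandNbhd, Finset.sum_filter]
  rfl

lemma card_rawWindow_le (r : ℕ) (k : Fin d) :
    ((rawWindow n m r k).card : ℝ) ≤ (n + m) * (2 * r) := by
  have h := sum_rawWindow (n := n) (m := m) r k (fun _ => 1)
  have hc : ((bandNbhd r k).card : ℝ) ≤ 2 * r := by exact_mod_cast card_bandNbhd_le r k
  simp only [Finset.sum_const, nsmul_eq_mul, mul_one, Finset.card_univ, Fintype.card_fin] at h
  rw [h, ← add_mul]
  gcongr

/-- The contribution of row `k` as a function of the raw variables. -/
def rowFun (A B : Matrix (Fin d) (Fin d) ℝ) (μ : Fin d → ℝ) (p : Fin n) (k : Fin d)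
    (v : (Fin n × Fin d) ⊕ (Fin m × Fin d) → ℝ) : EuclideanSpace ℝ (Fin 2) :=
  rowTerm A B μ (fun i l v => v (.inl (i, l))) (fun j l v => v (.inr (j, l))) p k v

lemma measurable_rowFun (A B : Matrix (Fin d) (Fin d) ℝ) (μ : Fin d → ℝ) (p : Fin n) (k : Fin d) :
    Measurable (rowFun (m := m) A B μ p k) := by
  apply Continuous.measurable
  unfold rowFun rowTerm dotProduct
  refine (PiLp.continuous_toLp 2 _).comp (continuous_pi fun a => ?_)
  fin_cases a
  · simp only [Fin.zero_eta, Matrix.cons_val_zero]; fun_prop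
  · simp only [Fin.mk_one, Matrix.cons_val_one, Matrix.cons_val_fin_one]; fun_prop

variable {A B : Matrix (Fin d) (Fin d) ℝ} {μ : Fin d → ℝ} {r : ℕ}

lemma dotProduct_eq_sum_bandNbhd (hA : ∀ i j : Fin d, (r : ℤ) ≤ |(i : ℤ) - (j : ℤ)| → A i j = 0)
    (k : Fin d) (u : Fin d → ℝ) : A k ⬝ᵥ u = ∑ l ∈ bandNbhd r k, A k l * u l := by
  rw [dotProduct, eq_comm]
  refine Finset.sum_subset (Finset.subset_univ _) fun l _ hl => ?_
  rw [hA k l (by simpa [bandNbhd] using hl), zero_mul]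

lemma rowFun_congr (hA : ∀ i j : Fin d, (r : ℤ) ≤ |(i : ℤ) - (j : ℤ)| → A i j = 0)
    (hB : ∀ i j : Fin d, (r : ℤ) ≤ |(i : ℤ) - (j : ℤ)| → B i j = 0) (p : Fin n) (k : Fin d)
    (v w : (Fin n × Fin d) ⊕ (Fin m × Fin d) → ℝ) (h : ∀ i ∈ rawWindow n m r k, v i = w i) :
    rowFun A B μ p k v = rowFun A B μ p k w := by
  have hx : ∀ i, A k ⬝ᵥ (fun l => v (.inl (i, l))) = A k ⬝ᵥ (fun l => w (.inl (i, l))) := by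
    intro i
    rw [dotProduct_eq_sum_bandNbhd hA, dotProduct_eq_sum_bandNbhd hA]
    refine Finset.sum_congr rfl fun l hl => ?_
    rw [h (.inl (i, l)) (by simpa [mem_rawWindow, rawCol, bandNbhd] using hl)]
  have hy : ∀ j, B k ⬝ᵥ (fun l => v (.inr (j, l))) = B k ⬝ᵥ (fun l => w (.inr (j, l))) := by
    intro j
    rw [dotProduct_eq_sum_bandNbhd hB, dotProduct_eq_sum_bandNbhd hB]
    refine Finset.sum_congr rfl fun l hl => ?_
    rw [h (.inr (j, l)) (by simpa [mem_rawWindow, rawCol, bandNbhd] using hl)]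
  simp only [rowFun, rowTerm, hx, hy]

lemma abs_dotProduct_le {c : ℝ}
    (hA : ∀ i j : Fin d, (r : ℤ) ≤ |(i : ℤ) - (j : ℤ)| → A i j = 0)
    (hAc : ∀ i j, |A i j| ≤ c) (k : Fin d) (u : Fin d → ℝ) :
    |A k ⬝ᵥ u| ≤ c * ∑ l ∈ bandNbhd r k, |u l| := by
  rw [dotProduct_eq_sum_bandNbhd hA, Finset.mul_sum]
  refine (Finset.abs_sum_le_sum_abs _ _).trans (Finset.sum_le_sum fun l _ => ?_)
  rw [abs_mul]
  gcongr
  exact hAc k l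

lemma norm_euclidean_two_le {u w : ℝ} (hu : 0 ≤ u) (hw : 0 ≤ w) :
    ‖(!₂[u, w] : EuclideanSpace ℝ (Fin 2))‖ ≤ u + w := by
  rw [EuclideanSpace.norm_eq, Real.sqrt_le_left (by positivity)]
  simp
  nlinarith

lemma one_div_mul_sum_le {ι : Type*} {s : Finset ι} {f : ι → ℝ} {b N : ℝ} (hb : 0 ≤ b)
    (hf : ∀ i ∈ s, f i ≤ b) (hN : (s.card : ℝ) = N) : 1 / N * ∑ i ∈ s, f i ≤ b := by
  have h0 : 0 ≤ N := hN ▸ Nat.cast_nonneg _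
  calc 1 / N * ∑ i ∈ s, f i ≤ 1 / N * ∑ i ∈ s, b := by
        gcongr with i hi; exact hf i hi
    _ = N / N * b := by rw [Finset.sum_const, nsmul_eq_mul, hN]; ring
    -- An empty average is covered too, since `0 / 0 = 0`.
    _ ≤ 1 * b := by gcongr; exact div_self_le_one _
    _ = b := one_mul b

/-- With `q` the sum of `|v i|` over the window, all dot products are at most `c q`. The two
coordinates are then at most `4 c² q²` and `(2 c q + μ₀)² ≤ 8 c² q² + 2 μ₀²`, whence 12;
Cauchy–Schwarz bounds `q²` by the window size times the sum of squares. -/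
lemma norm_rowFun_le {c μ₀ : ℝ}
    (hA : ∀ i j : Fin d, (r : ℤ) ≤ |(i : ℤ) - (j : ℤ)| → A i j = 0)
    (hB : ∀ i j : Fin d, (r : ℤ) ≤ |(i : ℤ) - (j : ℤ)| → B i j = 0)
    (hAc : ∀ i j, |A i j| ≤ c) (hBc : ∀ i j, |B i j| ≤ c) (hμ : ∀ i, |μ i| ≤ μ₀)
    (p : Fin n) (k : Fin d) (v : (Fin n × Fin d) ⊕ (Fin m × Fin d) → ℝ) :
    ‖rowFun A B μ p k v‖ ≤ (12 * c ^ 2 * ((n + m) * (2 * r)) + 2 * μ₀ ^ 2) *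
      (1 + ∑ i ∈ rawWindow n m r k, v i ^ 2) := by
  have hc : 0 ≤ c := (abs_nonneg _).trans (hAc k k)
  set q := ∑ i ∈ rawWindow n m r k, |v i| with hq
  have hq1 : ∀ i, ∑ l ∈ bandNbhd r k, |v (.inl (i, l))| ≤ q := by
    intro i
    rw [hq, sum_rawWindow]
    have h1 := Finset.single_le_sum (f := fun i => ∑ l ∈ bandNbhd r k, |v (.inl (i, l))|)
      (fun i _ => by positivity) (Finset.mem_univ i)
    have h2 : 0 ≤ ∑ q, ∑ l ∈ bandNbhd r k, |v (.inr (q, l))| := by positivity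
    linarith
  have hq2 : ∀ j, ∑ l ∈ bandNbhd r k, |v (.inr (j, l))| ≤ q := by
    intro j
    rw [hq, sum_rawWindow]
    have h1 := Finset.single_le_sum (f := fun i => ∑ l ∈ bandNbhd r k, |v (.inr (i, l))|)
      (fun i _ => by positivity) (Finset.mem_univ j)
    have h2 : 0 ≤ ∑ q, ∑ l ∈ bandNbhd r k, |v (.inl (q, l))| := by positivity
    linarith
  have hx : ∀ i, |A k ⬝ᵥ (fun l => v (.inl (i, l)))| ≤ c * q := fun i =>
    (abs_dotProduct_le hA hAc k _).trans (by gcongr; exact hq1 i)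
  have hy : ∀ j, |B k ⬝ᵥ (fun l => v (.inr (j, l)))| ≤ c * q := fun j =>
    (abs_dotProduct_le hB hBc k _).trans (by gcongr; exact hq2 j)
  have hqs : q ^ 2 ≤ (n + m) * (2 * r) * ∑ i ∈ rawWindow n m r k, v i ^ 2 := by
    refine (sq_sum_le_card_mul_sum_sq).trans ?_
    simp only [sq_abs]
    gcongr
    exact card_rawWindow_le r k
  have hcard : (((Finset.univ : Finset (Fin n)).erase p).card : ℝ) = (n : ℝ) - 1 := by
    rw [Finset.card_erase_of_mem (Finset.mem_univ p), Finset.card_univ, Fintype.card_fin,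
      Nat.cast_sub (by have := p.2; omega), Nat.cast_one]
  have hn0 : 0 ≤ (n : ℝ) - 1 := hcard ▸ Nat.cast_nonneg _
  unfold rowFun rowTerm
  refine (norm_euclidean_two_le (by positivity) (by positivity)).trans ?_
  have h1 : 1 / ((n : ℝ) - 1) * ∑ j ∈ Finset.univ.erase p,
      (A k ⬝ᵥ (fun l => v (.inl (j, l))) - A k ⬝ᵥ (fun l => v (.inl (p, l)))) ^ 2 ≤
      4 * c ^ 2 * q ^ 2 := by
    refine one_div_mul_sum_le (by positivity) (fun j _ => ?_) hcard
    have a1 := abs_le.1 (hx j)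
    have a2 := abs_le.1 (hx p)
    calc _ ≤ (2 * (c * q)) ^ 2 := sq_le_sq' (by linarith) (by linarith)
      _ = _ := by ring
  have h2 : 1 / (m : ℝ) * ∑ j, (B k ⬝ᵥ (fun l => v (.inr (j, l))) -
      A k ⬝ᵥ (fun l => v (.inl (p, l))) + μ k) ^ 2 ≤ 8 * c ^ 2 * q ^ 2 + 2 * μ₀ ^ 2 := by
    refine one_div_mul_sum_le (by positivity) (fun j _ => ?_) (by simp)
    have a1 := abs_le.1 (hy j)
    have a2 := abs_le.1 (hx p)
    have a3 := abs_le.1 (hμ k)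
    calc _ ≤ (2 * (c * q) + μ₀) ^ 2 := sq_le_sq' (by linarith) (by linarith)
      _ ≤ _ := by nlinarith [sq_nonneg (2 * (c * q) - μ₀)]
  have hs : 0 ≤ ∑ i ∈ rawWindow n m r k, v i ^ 2 := by positivity
  have h3 : c ^ 2 * q ^ 2 ≤
      c ^ 2 * ((n + m) * (2 * r) * ∑ i ∈ rawWindow n m r k, v i ^ 2) := by gcongr
  have h4 : 0 ≤ c ^ 2 * ((n + m) * (2 * r) : ℝ) := by positivity
  have h5 : 0 ≤ μ₀ ^ 2 * ∑ i ∈ rawWindow n m r k, v i ^ 2 := by positivity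
  refine (add_le_add h1 h2).trans ?_
  nlinarith

/-- Expanding the squared norms by coordinates and exchanging the sums exhibits the distance mean
vector as a sum of locally dependent terms. -/
lemma distMean_eq_sum_rowTerm {Ω : Type*} (A B : Matrix (Fin d) (Fin d) ℝ) (μ : Fin d → ℝ)
    (x : Fin n → Fin d → Ω → ℝ) (y : Fin m → Fin d → Ω → ℝ) (p : Fin n) (ω : Ω) :
    distMean A B μ x y p ω = ∑ k, rowTerm A B μ x y p k ω := by
  ext a
  fin_cases a
  · simp [distMean, rowTerm, EuclideanSpace.norm_sq_eq, obsX, mulVec]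
    rw [← Finset.mul_sum, Finset.sum_comm]
  · simp [distMean, rowTerm, EuclideanSpace.norm_sq_eq, obsX, obsY, mulVec]
    rw [← Finset.mul_sum, Finset.sum_comm]
    congr 1
    refine Finset.sum_congr rfl fun _ _ => Finset.sum_congr rfl fun _ _ => ?_
    ring

end Band

/-! ### Moments and dependence of the rows for the random sample -/

section Sample

variable {Ω : Type*} [MeasurableSpace Ω] {P : Measure Ω} {n m d : ℕ}
  {Fx Fy : Measure ℝ} {x : Fin n → Fin d → Ω → ℝ} {y : Fin m → Fin d → Ω → ℝ}

/-- All raw variables as one family. -/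
def rawVar (x : Fin n → Fin d → Ω → ℝ) (y : Fin m → Fin d → Ω → ℝ) :
    (Fin n × Fin d) ⊕ (Fin m × Fin d) → Ω → ℝ :=
  Sum.elim (fun p => x p.1 p.2) (fun q => y q.1 q.2)

lemma rowTerm_eq_rowFun {Ω : Type*} (A B : Matrix (Fin d) (Fin d) ℝ) (μ : Fin d → ℝ)
    (x : Fin n → Fin d → Ω → ℝ) (y : Fin m → Fin d → Ω → ℝ) (p : Fin n) (k : Fin d) :
    rowTerm A B μ x y p k = fun ω => rowFun A B μ p k (fun i => rawVar x y i ω) := by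
  funext ω
  simp only [rowTerm, rowFun, rawVar, Sum.elim_inl, Sum.elim_inr]

lemma RawSample.aemeasurable (h : RawSample P Fx Fy x y) (i) : AEMeasurable (rawVar x y i) P := by
  rcases i with ⟨i, k⟩ | ⟨j, k⟩
  · exact (h.law_x i k).aemeasurable
  · exact (h.law_y j k).aemeasurable

lemma integrable_comp_of_hasLaw {F : Measure ℝ} {X : Ω → ℝ} (hX : HasLaw X F P) {g : ℝ → ℝ}
    (hg : Integrable g F) : Integrable (fun ω => g (X ω)) P := by
  rw [← hX.map_eq] at hg
  exact hg.comp_aemeasurable hX.aemeasurable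

lemma RawSample.integrable_comp (h : RawSample P Fx Fy x y) {g : ℝ → ℝ} (hx : Integrable g Fx)
    (hy : Integrable g Fy) (i) : Integrable (fun ω => g (rawVar x y i ω)) P := by
  rcases i with ⟨i, k⟩ | ⟨j, k⟩
  · exact integrable_comp_of_hasLaw (h.law_x i k) hx
  · exact integrable_comp_of_hasLaw (h.law_y j k) hy

lemma RawSample.integral_comp_le (h : RawSample P Fx Fy x y) {g : ℝ → ℝ} (hx : Integrable g Fx)
    (hy : Integrable g Fy) {γ : ℝ} (hxγ : ∫ u, g u ∂Fx ≤ γ) (hyγ : ∫ u, g u ∂Fy ≤ γ) (i) :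
    ∫ ω, g (rawVar x y i ω) ∂P ≤ γ := by
  rcases i with ⟨i, k⟩ | ⟨j, k⟩
  · exact ((h.law_x i k).integral_comp hx.aestronglyMeasurable).trans_le hxγ
  · exact ((h.law_y j k).integral_comp hy.aestronglyMeasurable).trans_le hyγ

variable {A B : Matrix (Fin d) (Fin d) ℝ} {μ : Fin d → ℝ} {r : ℕ}

lemma RawSample.isDependencyNbhd (h : RawSample P Fx Fy x y)
    (hA : ∀ i j : Fin d, (r : ℤ) ≤ |(i : ℤ) - (j : ℤ)| → A i j = 0)
    (hB : ∀ i j : Fin d, (r : ℤ) ≤ |(i : ℤ) - (j : ℤ)| → B i j = 0) (p : Fin n) :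
    IsDependencyNbhd P (bandNbhd (2 * r)) (fun k => rowTerm A B μ x y p k) :=
  isDependencyNbhd_of_iIndepFun (V := rawVar x y) h.indep h.aemeasurable
    (N := rawWindow n m r) (Φ := fun k => rowFun A B μ p k) (fun _ => measurable_rowFun _ _ _ _ _)
    (fun k v w hvw => rowFun_congr hA hB p k v w hvw) (fun _ _ hst => disjoint_rawWindow hst)

lemma RawSample.aemeasurable_rowTerm (h : RawSample P Fx Fy x y) (p : Fin n) (k : Fin d) :
    AEMeasurable (rowTerm A B μ x y p k) P := by
  rw [rowTerm_eq_rowFun]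
  exact (measurable_rowFun A B μ p k).comp_aemeasurable (aemeasurable_pi_lambda _ h.aemeasurable)

lemma RawSample.memLp_rowTerm [IsProbabilityMeasure P] (h : RawSample P Fx Fy x y)
    (hFx : Integrable (fun u : ℝ => u ^ 4) Fx) (hFy : Integrable (fun u : ℝ => u ^ 4) Fy)
    {c μ₀ : ℝ} (hA : ∀ i j : Fin d, (r : ℤ) ≤ |(i : ℤ) - (j : ℤ)| → A i j = 0)
    (hB : ∀ i j : Fin d, (r : ℤ) ≤ |(i : ℤ) - (j : ℤ)| → B i j = 0)
    (hAc : ∀ i j, |A i j| ≤ c) (hBc : ∀ i j, |B i j| ≤ c) (hμ : ∀ i, |μ i| ≤ μ₀)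
    (p : Fin n) (k : Fin d) : MemLp (rowTerm A B μ x y p k) 2 P := by
  have hm := h.aemeasurable
  have hsq : ∀ i, MemLp (fun ω => rawVar x y i ω ^ 2) 2 P := by
    intro i
    rw [memLp_two_iff_integrable_sq (by have := hm i; fun_prop)]
    refine (h.integrable_comp hFx hFy i).congr (Eventually.of_forall fun ω => ?_)
    simp only; ring
  have hsum : MemLp (fun ω => ∑ i ∈ rawWindow n m r k, rawVar x y i ω ^ 2) 2 P :=
    memLp_finsetSum _ fun i _ => hsq i
  have hone : MemLp (fun ω => 1 + ∑ i ∈ rawWindow n m r k, rawVar x y i ω ^ 2) 2 P :=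
    (memLp_const (1 : ℝ)).add hsum
  have hdom := hone.const_mul (12 * c ^ 2 * ((n + m) * (2 * r)) + 2 * μ₀ ^ 2)
  refine hdom.mono' (h.aemeasurable_rowTerm p k).aestronglyMeasurable ?_
  rw [rowTerm_eq_rowFun]
  refine Eventually.of_forall fun ω => ?_
  exact norm_rowFun_le hA hB hAc hBc hμ p k (fun i => rawVar x y i ω)

/-- The point is uniformity: neither the truncation level nor the bound involves `d` or `k`. -/
lemma RawSample.integral_sq_sub_trunc_le [IsProbabilityMeasure P] (h : RawSample P Fx Fy x y)
    (hFx : Integrable (fun u : ℝ => u ^ 4) Fx) (hFy : Integrable (fun u : ℝ => u ^ 4) Fy)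
    {c μ₀ : ℝ} (hA : ∀ i j : Fin d, (r : ℤ) ≤ |(i : ℤ) - (j : ℤ)| → A i j = 0)
    (hB : ∀ i j : Fin d, (r : ℤ) ≤ |(i : ℤ) - (j : ℤ)| → B i j = 0)
    (hAc : ∀ i j, |A i j| ≤ c) (hBc : ∀ i j, |B i j| ≤ c) (hμ : ∀ i, |μ i| ≤ μ₀)
    (p : Fin n) (k : Fin d) (ξ : EuclideanSpace ℝ (Fin 2)) {L C b γ : ℝ}
    (hL : L = (n + m) * (2 * r)) (hC : C = (12 * c ^ 2 * L + 2 * μ₀ ^ 2) * ‖ξ‖) (hb : 0 ≤ b)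
    (hxγ : ∫ u, max (u ^ 2 - b) 0 ^ 2 ∂Fx ≤ γ) (hyγ : ∫ u, max (u ^ 2 - b) 0 ^ 2 ∂Fy ≤ γ) :
    ∫ ω, (inner ℝ (rowTerm A B μ x y p k ω) ξ - trunc (2 * (C * (1 + L * b)))
      (inner ℝ (rowTerm A B μ x y p k ω) ξ)) ^ 2 ∂P ≤ 4 * C ^ 2 * L ^ 2 * γ := by
  have hL0 : 0 ≤ L := by rw [hL]; positivity
  have hC0 : 0 ≤ C := by rw [hC]; positivity
  have hγ : 0 ≤ γ := (integral_nonneg fun u => sq_nonneg _).trans hxγ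
  have ix := integrable_max_sq_sub hFx hb
  have iy := integrable_max_sq_sub hFy hb
  rw [rowTerm_eq_rowFun]
  refine BandCLT.integral_sq_sub_trunc_le (V := rawVar x y) (N := rawWindow n m r k) hL0
    (hL ▸ card_rawWindow_le r k) hC0 hb hγ (fun ω => ?_)
    (fun i => h.integrable_comp ix iy i) (fun i => h.integral_comp_le ix iy hxγ hyγ i)
  refine (abs_real_inner_le_norm _ _).trans ?_
  rw [hC, mul_right_comm, hL]
  gcongr
  exact norm_rowFun_le hA hB hAc hBc hμ p k _

end Sample

end

end BandCLT

/-! ### Covariance matrices, Gaussian laws and weak convergence -/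

namespace BandCLT

noncomputable section

section CovMat

variable {Ω : Type*} [MeasurableSpace Ω] {P : Measure Ω}

lemma inner_euclidean_two (u ξ : EuclideanSpace ℝ (Fin 2)) :
    inner ℝ u ξ = ∑ a, ξ a * u a := by
  simp [PiLp.inner_apply]

lemma covMat_isSymm (V : Ω → EuclideanSpace ℝ (Fin 2)) (a b : Fin 2) :
    covMat P V a b = covMat P V b a := covariance_comm _ _

lemma memLp_coord {V : Ω → EuclideanSpace ℝ (Fin 2)} (hV : MemLp V 2 P) (a : Fin 2) :
    MemLp (fun ω => V ω a) 2 P :=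
  (EuclideanSpace.proj (𝕜 := ℝ) a).comp_memLp' hV

lemma variance_inner_eq [IsProbabilityMeasure P] {V : Ω → EuclideanSpace ℝ (Fin 2)}
    (hV : MemLp V 2 P) (ξ : EuclideanSpace ℝ (Fin 2)) :
    Var[fun ω => inner ℝ (V ω) ξ; P] = ξ ⬝ᵥ covMat P V *ᵥ ξ := by
  have h : ∀ a, MemLp (fun ω => ξ a * V ω a) 2 P := fun a => (memLp_coord hV a).const_mul _
  simp only [inner_euclidean_two]
  rw [variance_fun_sum h]
  simp only [dotProduct, mulVec, covMat, Matrix.of_apply, Finset.mul_sum]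
  refine Finset.sum_congr rfl fun a _ => Finset.sum_congr rfl fun b _ => ?_
  rw [covariance_const_mul_left, covariance_const_mul_right]
  ring

lemma posSemidef_of_limit {S : Matrix (Fin 2) (Fin 2) ℝ} (hs : ∀ a b, S a b = S b a)
    (hq : ∀ ξ : Fin 2 → ℝ, 0 ≤ ξ ⬝ᵥ S *ᵥ ξ) : S.PosSemidef := by
  refine Matrix.PosSemidef.of_dotProduct_mulVec_nonneg ?_ fun ξ => by simpa using hq ξ
  ext a b
  simpa using hs b a

lemma posSemidef_smul_covMat [IsProbabilityMeasure P] {V : Ω → EuclideanSpace ℝ (Fin 2)}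
    (hV : MemLp V 2 P) {c : ℝ} (hc : 0 ≤ c) : (c • covMat P V).PosSemidef := by
  refine posSemidef_of_limit (fun a b => ?_) fun ξ => ?_
  · simp [covMat_isSymm V a b]
  · rw [smul_mulVec, dotProduct_smul, ← variance_inner_eq hV (WithLp.toLp 2 ξ)]
    exact mul_nonneg hc (variance_nonneg _ _)

lemma PosSemidef.of_tendsto {ι : Type*} {l : Filter ι} [l.NeBot]
    {Q : ι → Matrix (Fin 2) (Fin 2) ℝ} {S : Matrix (Fin 2) (Fin 2) ℝ}
    (hQ : ∀ i, (Q i).PosSemidef) (h : Tendsto Q l (𝓝 S)) : S.PosSemidef := by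
  have he : ∀ a b, Tendsto (fun i => Q i a b) l (𝓝 (S a b)) := fun a b =>
    ((continuous_id.matrix_elem a b).tendsto S).comp h
  refine posSemidef_of_limit (fun a b => ?_) fun ξ => ?_
  · refine tendsto_nhds_unique (he a b) ((he b a).congr fun i => ?_)
    simpa using (hQ i).isHermitian.apply a b
  · have hc : Continuous fun M : Matrix (Fin 2) (Fin 2) ℝ => ξ ⬝ᵥ M *ᵥ ξ := by fun_prop
    exact ge_of_tendsto' ((hc.tendsto S).comp h)
      fun i => by simpa using (hQ i).dotProduct_mulVec_nonneg ξ

/-- A sequence of matrices with uniformly bounded entries has a convergent subsequence. -/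
lemma exists_subseq_tendsto_of_abs_le {Q : ℕ → Matrix (Fin 2) (Fin 2) ℝ} {C : ℝ}
    (hQ : ∀ k a b, |Q k a b| ≤ C) :
    ∃ S, ∃ ψ : ℕ → ℕ, StrictMono ψ ∧ Tendsto (fun k => Q (ψ k)) atTop (𝓝 S) := by
  have hc : IsCompact (Set.univ.pi fun _ : Fin 2 => Set.univ.pi fun _ : Fin 2 => Set.Icc (-C) C) :=
    isCompact_univ_pi fun _ => isCompact_univ_pi fun _ => isCompact_Icc
  obtain ⟨S, -, ψ, hψ, h⟩ := hc.tendsto_subseq (x := fun k a b => Q k a b)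
    (fun k a _ b _ => abs_le.1 (hQ k a b))
  exact ⟨S, ψ, hψ, h⟩

end CovMat

section Weak

variable {Q : ℕ → Matrix (Fin 2) (Fin 2) ℝ} {S : Matrix (Fin 2) (Fin 2) ℝ}

lemma charFun_multivariateGaussian_zero (hS : S.PosSemidef) (ξ : EuclideanSpace ℝ (Fin 2)) :
    charFun (multivariateGaussian 0 S) ξ = (Real.exp (-(ξ ⬝ᵥ S *ᵥ ξ) / 2) : ℂ) := by
  rw [charFun_multivariateGaussian hS]
  push_cast
  congr 1
  simp
  ring

/-- The characteristic function depends continuously on the covariance and involves no inverse, so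
singular limits are allowed. -/
lemma tendsto_charFun_multivariateGaussian (hQ : ∀ k, (Q k).PosSemidef)
    (h : Tendsto Q atTop (𝓝 S)) (ξ : EuclideanSpace ℝ (Fin 2)) :
    Tendsto (fun k => charFun (multivariateGaussian 0 (Q k)) ξ) atTop
      (𝓝 (charFun (multivariateGaussian 0 S) ξ)) := by
  simp only [charFun_multivariateGaussian_zero (hQ _),
    charFun_multivariateGaussian_zero (PosSemidef.of_tendsto hQ h)]
  have hc : Continuous fun M : Matrix (Fin 2) (Fin 2) ℝ =>
      (Real.exp (-(ξ.ofLp ⬝ᵥ M *ᵥ ξ.ofLp) / 2) : ℂ) := by fun_prop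
  exact (hc.tendsto S).comp h

lemma tendsto_integral_multivariateGaussian (hQ : ∀ k, (Q k).PosSemidef)
    (h : Tendsto Q atTop (𝓝 S))
    (f : BoundedContinuousFunction (EuclideanSpace ℝ (Fin 2)) ℝ) :
    Tendsto (fun k => ∫ z, f z ∂(multivariateGaussian 0 (Q k))) atTop
      (𝓝 (∫ z, f z ∂(multivariateGaussian 0 S))) := by
  have hw : Tendsto (β := ProbabilityMeasure (EuclideanSpace ℝ (Fin 2)))
      (fun k => ⟨multivariateGaussian 0 (Q k), inferInstance⟩) atTop
      (𝓝 ⟨multivariateGaussian 0 S, inferInstance⟩) :=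
    ProbabilityMeasure.tendsto_iff_tendsto_charFun.2 fun ξ =>
      tendsto_charFun_multivariateGaussian hQ h ξ
  exact ProbabilityMeasure.tendsto_iff_forall_integral_tendsto.1 hw f

end Weak

/-- Three forms of asymptotic normality, deduced from the pointwise comparison
of characteristic functions when the covariance matrices are bounded. -/
theorem asymptotic_normality_of_charFun {Ω : ℕ → Type*} [∀ d, MeasurableSpace (Ω d)]
    {P : ∀ d, Measure (Ω d)} [∀ d, IsProbabilityMeasure (P d)]
    {Z : ∀ d, Ω d → EuclideanSpace ℝ (Fin 2)} (hZ : ∀ d, AEMeasurable (Z d) (P d))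
    {Q : ℕ → Matrix (Fin 2) (Fin 2) ℝ} (hQ : ∀ d, (Q d).PosSemidef) {C : ℝ}
    (hC : ∀ d a b, |Q d a b| ≤ C)
    (h : ∀ ξ, Tendsto (fun d => charFun ((P d).map (Z d)) ξ -
      charFun (multivariateGaussian 0 (Q d)) ξ) atTop (𝓝 0)) :
    (∀ f : BoundedContinuousFunction (EuclideanSpace ℝ (Fin 2)) ℝ,
      Tendsto (fun d : ℕ => ∫ ω, f (Z d ω) ∂(P d) - ∫ z, f z ∂(multivariateGaussian 0 (Q d)))
        atTop (𝓝 0)) ∧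
    (∀ S : Matrix (Fin 2) (Fin 2) ℝ, Tendsto Q atTop (𝓝 S) →
      TendstoInDistribution Z atTop
        (id : EuclideanSpace ℝ (Fin 2) → EuclideanSpace ℝ (Fin 2)) P
        (multivariateGaussian 0 S)) ∧
    (∀ φ : ℕ → ℕ, StrictMono φ → ∃ ψ : ℕ → ℕ, StrictMono ψ ∧
      ∃ S : Matrix (Fin 2) (Fin 2) ℝ, S.PosSemidef ∧
        TendstoInDistribution (fun k => Z (φ (ψ k))) atTop
          (id : EuclideanSpace ℝ (Fin 2) → EuclideanSpace ℝ (Fin 2)) (fun k => P (φ (ψ k)))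
          (multivariateGaussian 0 S)) := by
  -- Along indices where the covariances converge, the assumed comparison and the Gaussian limit add
  -- up to convergence of characteristic functions, and Lévy's theorem applies.
  have key : ∀ (φ : ℕ → ℕ), Tendsto φ atTop atTop → ∀ S : Matrix (Fin 2) (Fin 2) ℝ,
      Tendsto (fun k => Q (φ k)) atTop (𝓝 S) →
      TendstoInDistribution (fun k => Z (φ k)) atTop
        (id : EuclideanSpace ℝ (Fin 2) → EuclideanSpace ℝ (Fin 2)) (fun k => P (φ k))
        (multivariateGaussian 0 S) := by
    intro φ hφ S hS
    refine ⟨fun k => hZ (φ k), aemeasurable_id, ?_⟩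
    refine ProbabilityMeasure.tendsto_iff_tendsto_charFun.2 fun ξ => ?_
    simp only [ProbabilityMeasure.coe_mk, Measure.map_id]
    have h1 := ((h ξ).comp hφ).add (tendsto_charFun_multivariateGaussian (fun k => hQ (φ k)) hS ξ)
    simpa using h1
  refine ⟨fun f => ?_, fun S hS => key id tendsto_id S hS, fun φ hφ => ?_⟩
  -- `Q` itself need not converge. Along a suitable subsequence both integrals tend to the same
  -- Gaussian integral, so their difference tends to 0.
  · refine tendsto_of_subseq_tendsto fun φ hφ => ?_
    obtain ⟨S, ψ, hψ, hS⟩ := exists_subseq_tendsto_of_abs_le (Q := fun k => Q (φ k))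
      (fun k => hC (φ k))
    refine ⟨ψ, ?_⟩
    have h1 := (key (fun k => φ (ψ k)) (hφ.comp hψ.tendsto_atTop) S hS).tendsto
    have h2 := ProbabilityMeasure.tendsto_iff_forall_integral_tendsto.1 h1 f
    have h3 := tendsto_integral_multivariateGaussian (fun k => hQ (φ (ψ k))) hS f
    simp only [ProbabilityMeasure.coe_mk, Measure.map_id] at h2
    have h4 := h2.sub h3
    rw [sub_self] at h4
    refine h4.congr fun k => ?_
    rw [integral_map (hZ _) f.continuous.aestronglyMeasurable]
  · obtain ⟨S, ψ, hψ, hS⟩ := exists_subseq_tendsto_of_abs_le (Q := fun k => Q (φ k))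
      (fun k => hC (φ k))
    exact ⟨ψ, hψ, S, PosSemidef.of_tendsto (fun k => hQ (φ (ψ k))) hS,
      key (fun k => φ (ψ k)) (hφ.tendsto_atTop.comp hψ.tendsto_atTop) S hS⟩

section RowSums

variable {Ω : Type*} [MeasurableSpace Ω] {P : Measure Ω}

lemma inner_centered_sum_eq {κ : Type*} [Fintype κ] {R : κ → Ω → EuclideanSpace ℝ (Fin 2)}
    (hR : ∀ k, Integrable (R k) P) (c : ℝ) (ξ : EuclideanSpace ℝ (Fin 2)) (ω : Ω) :
    inner ℝ (c • (∑ k, R k ω - ∫ ω', ∑ k, R k ω' ∂P)) ξ =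
      ∑ k, c * (inner ℝ (R k ω) ξ - ∫ ω', inner ℝ (R k ω') ξ ∂P) := by
  have hi : ∀ k, ∫ ω', inner ℝ (R k ω') ξ ∂P = inner ℝ (∫ ω', R k ω' ∂P) ξ := by
    intro k
    simp only [real_inner_comm ξ]
    exact integral_inner (hR k) ξ
  rw [integral_finsetSum _ fun k _ => hR k, real_inner_smul_left, inner_sub_left, sum_inner,
    sum_inner, ← Finset.sum_sub_distrib, Finset.mul_sum]
  simp only [hi]

/-- Centring leaves the variance unchanged. For `c = 1/√d` the right side is the quadratic form in
the Gaussian characteristic function. -/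
lemma variance_centered_sum_eq [IsProbabilityMeasure P] {κ : Type*} [Fintype κ]
    {R : κ → Ω → EuclideanSpace ℝ (Fin 2)}
    (hR : ∀ k, MemLp (R k) 2 P) (c : ℝ) (ξ : EuclideanSpace ℝ (Fin 2)) :
    Var[fun ω => ∑ k, c * (inner ℝ (R k ω) ξ - ∫ ω', inner ℝ (R k ω') ξ ∂P); P] =
      ξ ⬝ᵥ (c ^ 2 • covMat P fun ω => ∑ k, R k ω) *ᵥ ξ := by
  have hD : MemLp (fun ω => ∑ k, R k ω) 2 P := memLp_finsetSum _ fun k _ => hR k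
  have hin : AEStronglyMeasurable (fun ω => inner ℝ (∑ k, R k ω) ξ) P :=
    hD.aestronglyMeasurable.inner aestronglyMeasurable_const
  rw [smul_mulVec, dotProduct_smul, ← variance_inner_eq hD ξ, smul_eq_mul, ← variance_const_mul,
    ← variance_sub_const (X := fun ω => c * inner ℝ (∑ k, R k ω) ξ) (by fun_prop)
      (∑ k, c * ∫ ω', inner ℝ (R k ω') ξ ∂P)]
  congr 1
  ext ω
  rw [sum_inner, Finset.mul_sum, ← Finset.sum_sub_distrib]
  simp only [mul_sub]

end RowSums

end

end BandCLT

/-! ### Uniformity in the dimension and conclusion -/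

namespace BandCLT

noncomputable section

/-- The truncated second moments of the rows, tested against a fixed vector, are uniformly small. -/
lemma uniform_truncation {n m : ℕ} {Fx Fy : Measure ℝ}
    (hFx : Integrable (fun u : ℝ => u ^ 4) Fx) (hFy : Integrable (fun u : ℝ => u ^ 4) Fy)
    {Ω : ℕ → Type*} [∀ d, MeasurableSpace (Ω d)]
    {P : ∀ d, Measure (Ω d)} [∀ d, IsProbabilityMeasure (P d)]
    {x : ∀ d, Fin n → Fin d → Ω d → ℝ} {y : ∀ d, Fin m → Fin d → Ω d → ℝ}
    (hxy : ∀ d, RawSample (P d) Fx Fy (x d) (y d))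
    {A B : ∀ d, Matrix (Fin d) (Fin d) ℝ} {μ : ∀ d, Fin d → ℝ} {r : ℕ} {c μ₀ : ℝ}
    (hA : ∀ d (i j : Fin d), (r : ℤ) ≤ |(i : ℤ) - (j : ℤ)| → A d i j = 0)
    (hB : ∀ d (i j : Fin d), (r : ℤ) ≤ |(i : ℤ) - (j : ℤ)| → B d i j = 0)
    (hAc : ∀ d (i j : Fin d), |A d i j| ≤ c) (hBc : ∀ d (i j : Fin d), |B d i j| ≤ c)
    (hμ : ∀ d (i : Fin d), |μ d i| ≤ μ₀) (p : Fin n) (ξ : EuclideanSpace ℝ (Fin 2))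
    {ε : ℝ} (hε : 0 < ε) :
    ∃ M : ℝ, 0 ≤ M ∧ ∀ d k,
      ∫ ω, (inner ℝ (rowTerm (A d) (B d) (μ d) (x d) (y d) p k ω) ξ -
        trunc M (inner ℝ (rowTerm (A d) (B d) (μ d) (x d) (y d) p k ω) ξ)) ^ 2 ∂(P d) ≤ ε := by
  set L : ℝ := (n + m) * (2 * r) with hL
  set C : ℝ := (12 * c ^ 2 * L + 2 * μ₀ ^ 2) * ‖ξ‖ with hC
  -- The summand 1 keeps the denominator positive when `C` or `L` is 0.
  have hγ : 0 < ε / (4 * C ^ 2 * L ^ 2 + 1) := by positivity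
  obtain ⟨b, hbx, hby⟩ := (((tendsto_integral_max_sq_sub hFx).eventually (gt_mem_nhds hγ)).and
    ((tendsto_integral_max_sq_sub hFy).eventually (gt_mem_nhds hγ))).exists
  refine ⟨2 * (C * (1 + L * b)), by positivity, fun d k => ?_⟩
  refine ((hxy d).integral_sq_sub_trunc_le hFx hFy (hA d) (hB d) (hAc d) (hBc d) (hμ d) p k ξ hL hC
    (Nat.cast_nonneg b) hbx.le hby.le).trans ?_
  rw [mul_div_assoc', div_le_iff₀ (by positivity)]
  nlinarith

end

end BandCLT

open BandCLT

/-- Asymptotic normality of the distance mean vector. The rows are locally dependent with uniformly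
integrable squares, so the characteristic functions of `normalizedDist` and of the Gaussian law with
the same covariance approach each other; the Lyapunov condition on the blocks is not needed. -/
theorem theorem4p4 {n m : ℕ} (hn : 2 ≤ n) (hm : 1 ≤ m)
    (Fx Fy : Measure ℝ) [IsProbabilityMeasure Fx] [IsProbabilityMeasure Fy]
    (hFx_mean : ∫ u, u ∂Fx = 0) (hFx_four : Integrable (fun u : ℝ => u ^ 4) Fx)
    (hFy_mean : ∫ u, u ∂Fy = 0) (hFy_four : Integrable (fun u : ℝ => u ^ 4) Fy)
    {Ω : ℕ → Type*} [∀ d, MeasurableSpace (Ω d)]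
    (P : ∀ d, Measure (Ω d)) [∀ d, IsProbabilityMeasure (P d)]
    (x : ∀ d, Fin n → Fin d → Ω d → ℝ) (y : ∀ d, Fin m → Fin d → Ω d → ℝ)
    (hxy : ∀ d, BandCLT.RawSample (P d) Fx Fy (x d) (y d))
    (A B : ∀ d, Matrix (Fin d) (Fin d) ℝ) (μ : ∀ d, Fin d → ℝ)
    (m₀ : ℕ) (c₀ μ₀ : ℝ)
    (hA_band : ∀ d (i j : Fin d), (m₀ : ℤ) ≤ |(i : ℤ) - (j : ℤ)| → A d i j = 0)
    (hB_band : ∀ d (i j : Fin d), (m₀ : ℤ) ≤ |(i : ℤ) - (j : ℤ)| → B d i j = 0)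
    (hA_bdd : ∀ d (i j : Fin d), |A d i j| < c₀)
    (hB_bdd : ∀ d (i j : Fin d), |B d i j| < c₀)
    (hμ_bdd : ∀ d (i : Fin d), |μ d i| < μ₀)
    (h_cov : ∀ᶠ d in atTop,
      (BandCLT.blockCov (P d) m₀ (A d) (B d) (μ d) (x d) (y d) ⟨0, by omega⟩).PosDef)
    (h_lyap : Tendsto
      (fun d => BandCLT.lyapunovSum (P d) m₀ (A d) (B d) (μ d) (x d) (y d) ⟨0, by omega⟩)
      atTop (𝓝 0))
    (i : Fin n) :
    (∀ f : BoundedContinuousFunction (EuclideanSpace ℝ (Fin 2)) ℝ,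
      Tendsto (fun d : ℕ =>
        ∫ ω, f (BandCLT.normalizedDist (P d) (A d) (B d) (μ d) (x d) (y d) i ω) ∂(P d) -
        ∫ z, f z ∂(multivariateGaussian 0 ((1 / (d : ℝ)) •
          BandCLT.covMat (P d) (BandCLT.distMean (A d) (B d) (μ d) (x d) (y d) i))))
        atTop (𝓝 0)) ∧
    (∀ S : Matrix (Fin 2) (Fin 2) ℝ,
      Tendsto (fun d : ℕ => (1 / (d : ℝ)) •
        BandCLT.covMat (P d) (BandCLT.distMean (A d) (B d) (μ d) (x d) (y d) i)) atTop (𝓝 S) →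
      TendstoInDistribution
        (fun d => BandCLT.normalizedDist (P d) (A d) (B d) (μ d) (x d) (y d) i) atTop
        (id : EuclideanSpace ℝ (Fin 2) → EuclideanSpace ℝ (Fin 2)) P
        (multivariateGaussian 0 S)) ∧
    (∀ φ : ℕ → ℕ, StrictMono φ → ∃ ψ : ℕ → ℕ, StrictMono ψ ∧
      ∃ S : Matrix (Fin 2) (Fin 2) ℝ, S.PosSemidef ∧
        TendstoInDistribution
          (fun k => BandCLT.normalizedDist (P (φ (ψ k))) (A (φ (ψ k))) (B (φ (ψ k))) (μ (φ (ψ k)))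
            (x (φ (ψ k))) (y (φ (ψ k))) i) atTop
          (id : EuclideanSpace ℝ (Fin 2) → EuclideanSpace ℝ (Fin 2)) (fun k => P (φ (ψ k)))
          (multivariateGaussian 0 S)) := by
  set R : ∀ d, Fin d → Ω d → EuclideanSpace ℝ (Fin 2) := fun d k =>
    rowTerm (A d) (B d) (μ d) (x d) (y d) i k with hRdef
  have hR : ∀ d k, MemLp (R d k) 2 (P d) := fun d k =>
    (hxy d).memLp_rowTerm hFx_four hFy_four (hA_band d) (hB_band d) (fun a b => (hA_bdd d a b).le)
      (fun a b => (hB_bdd d a b).le) (fun a => (hμ_bdd d a).le) i k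
  have hdep : ∀ d, IsDependencyNbhd (P d) (bandNbhd (2 * m₀)) (R d) := fun d =>
    (hxy d).isDependencyNbhd (hA_band d) (hB_band d) i
  have hD : ∀ d, distMean (A d) (B d) (μ d) (x d) (y d) i = fun ω => ∑ k, R d k ω := fun d =>
    funext fun ω => distMean_eq_sum_rowTerm _ _ _ _ _ i ω
  have hDL : ∀ d, MemLp (distMean (A d) (B d) (μ d) (x d) (y d) i) 2 (P d) := fun d => by
    rw [hD]; exact memLp_finsetSum _ fun k _ => hR d k
  have hK : ∀ d (k : Fin d), ((bandNbhd (2 * m₀) k).card : ℝ) ≤ 4 * m₀ := fun d k => by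
    have := card_bandNbhd_le (2 * m₀) k
    have : ((bandNbhd (2 * m₀) k).card : ℝ) ≤ ((2 * (2 * m₀) : ℕ) : ℝ) := by exact_mod_cast this
    push_cast at this
    linarith
  have hui : ∀ ξ : EuclideanSpace ℝ (Fin 2), ∀ ε > 0, ∃ M : ℝ, 0 ≤ M ∧ ∀ d k,
      ∫ ω, (inner ℝ (R d k ω) ξ - trunc M (inner ℝ (R d k ω) ξ)) ^ 2 ∂(P d) ≤ ε := fun ξ ε hε =>
    uniform_truncation hFx_four hFy_four hxy hA_band hB_band (fun d a b => (hA_bdd d a b).le)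
      (fun d a b => (hB_bdd d a b).le) (fun d a => (hμ_bdd d a).le) i ξ hε
  have hT : ∀ ξ d k, MemLp (fun ω => inner ℝ (R d k ω) ξ) 2 (P d) := fun ξ d k =>
    (hR d k).inner_const ξ
  have hTdep : ∀ ξ d, IsDependencyNbhd (P d) (bandNbhd (2 * m₀))
      (fun k ω => inner ℝ (R d k ω) ξ) := fun ξ d =>
    (hdep d).comp (g := fun _ u => inner ℝ u ξ) (fun _ => by fun_prop)
  -- Each of the `d` rows has at most `4 m₀` nonzero covariances, so the variance of the sum grows
  -- at most linearly in `d`.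
  have hvar : ∀ ξ : EuclideanSpace ℝ (Fin 2), ∃ C : ℝ, ∀ d : ℕ,
      1 / (d : ℝ) * Var[fun ω => ∑ k, inner ℝ (R d k ω) ξ; P d] ≤ C := by
    intro ξ
    obtain ⟨M, hM, h⟩ := hui ξ 1 one_pos
    refine ⟨4 * m₀ * (M ^ 2 + 1), fun d => ?_⟩
    have h1 := (hTdep ξ d).variance_sum_le (hT ξ d) (hK d)
      fun k => variance_le_of_trunc (hT ξ d k) hM (h d k)
    rw [Fintype.card_fin] at h1
    calc _ ≤ 1 / (d : ℝ) * (d * (4 * m₀ * (M ^ 2 + 1))) := by gcongr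
      _ = d / d * (4 * m₀ * (M ^ 2 + 1)) := by ring
      _ ≤ 1 * (4 * m₀ * (M ^ 2 + 1)) := by gcongr; exact div_self_le_one _
      _ = _ := one_mul _
  have hbdd : ∃ C : ℝ, ∀ (d : ℕ) a b, |((1 / (d : ℝ)) •
      covMat (P d) (distMean (A d) (B d) (μ d) (x d) (y d) i)) a b| ≤ C := by
    -- Basis vectors as directions bound the diagonal entries; off-diagonal ones follow from `|cov|
    -- ≤ (Var + Var)/2`.
    choose C hC using fun a : Fin 2 => hvar (EuclideanSpace.single a 1)
    have hC' : ∀ a (d : ℕ), 1 / (d : ℝ) *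
        Var[fun ω => distMean (A d) (B d) (μ d) (x d) (y d) i ω a; P d] ≤ max (C 0) (C 1) := by
      intro a d
      have h1 := hC a d
      have h2 : C a ≤ max (C 0) (C 1) := by fin_cases a <;> simp
      refine le_trans (le_of_eq ?_) (h1.trans h2)
      have e : (fun ω => distMean (A d) (B d) (μ d) (x d) (y d) i ω a) =
          fun ω => ∑ k, inner ℝ (R d k ω) (EuclideanSpace.single a 1) := by
        ext ω
        rw [hD]
        simp [EuclideanSpace.inner_single_right]
      rw [e]
    refine ⟨max (C 0) (C 1), fun d a b => ?_⟩
    rw [Matrix.smul_apply, smul_eq_mul, abs_mul, abs_of_nonneg (by positivity)]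
    have h1 := abs_covariance_le (memLp_coord (hDL d) a) (memLp_coord (hDL d) b) one_pos
    rw [one_mul, div_one] at h1
    calc _ ≤ 1 / (d : ℝ) * ((Var[fun ω => distMean (A d) (B d) (μ d) (x d) (y d) i ω a; P d] +
          Var[fun ω => distMean (A d) (B d) (μ d) (x d) (y d) i ω b; P d]) / 2) := by
          gcongr; exact h1
      _ ≤ _ := by linarith [hC' a d, hC' b d]
  obtain ⟨C, hC⟩ := hbdd
  have hZm : ∀ d, AEMeasurable (normalizedDist (P d) (A d) (B d) (μ d) (x d) (y d) i) (P d) :=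
    fun d => by
      unfold normalizedDist
      exact ((hDL d).aemeasurable.sub_const _).const_smul (1 / √(d : ℝ))
  have hQ : ∀ d : ℕ, ((1 / (d : ℝ)) •
      covMat (P d) (distMean (A d) (B d) (μ d) (x d) (y d) i)).PosSemidef := fun d =>
    posSemidef_smul_covMat (hDL d) (by positivity)
  refine asymptotic_normality_of_charFun hZm hQ hC fun ξ => ?_
  -- The scalar theorem in direction `ξ` is already the required comparison, once both of its terms
  -- are recognized as characteristic functions at `ξ`.
  refine (tendsto_integral_cis_sub_exp (hTdep ξ) (hT ξ) hK (hui ξ)).congr fun d => ?_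
  rw [charFun_multivariateGaussian_zero (hQ d), charFun_apply,
    integral_map (hZm d) (by fun_prop), variance_centered_sum_eq (hR d), hD]
  have hsq : (1 / √(d : ℝ)) ^ 2 = 1 / (d : ℝ) := by
    rw [div_pow, one_pow, Real.sq_sqrt (Nat.cast_nonneg _)]
  rw [hsq]
  congr 2
  ext ω
  rw [normalizedDist, hD, inner_centered_sum_eq fun k => (hR d k).integrable one_le_two]
  rfl
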